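/- Conventions. A Scott domain is an $\omega$-algebraic bounded-complete pointed dcpo; $\mathbf{S}$ is the category of Scott domains and strict (i.e. $\bot$-preserving) Scott-continuous functions, with hom-sets ordered pointwise. For a context $\Xi$ of polarized type variables, $[\![\Xi]\!] = \prod_{\alpha\in\Xi}\mathbf{S}$, with hom-sets ordered componentwise. A functor between such categories is locally continuous if its action on every hom-set is Scott-continuous. Write $D_\bot$ for lifting, $\times,\prod$ for products, $\bigoplus$ for the coalesced sum, $[D\to E]$ for the space of continuous functions and $[D\to_{\bot}E]$ for the space of strict continuous functions, both ordered pointwise. Types. Positive and negative open session types $\Xi\vdash A\ \mathsf{type}^{\pm}$ and (closed) functional types $\tau$ are generated simultaneously by the following rules: $\mathbf{1}$ is positive; $\Xi,\alpha^p\vdash\alpha$ has polarity $p$; if $\Xi,\alpha^p\vdash A$ has polarity $p$, so has $\Xi\vdash\rho\alpha.A$; $\downarrow\! A$ is positive for $A$ negative, and $\uparrow\! A$ is negative for $A$ positive; $\oplus\{l:A_l\}_{l\in L}$ ($L$ a finite set of labels) is positive for all $A_l$ positive, and $\&\{l:A_l\}_{l\in L}$ is negative for all $A_l$ negative; $A\otimes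 B$ is positive for $A,B$ positive, and $A\multimap B$ is negative for $A$ positive and $B$ negative; $\tau\wedge A$ is positive for $A$ positive, and $\tau\supset A$ is negative for $A$ negative; $\{a_0:A_0\leftarrow a_1:A_1,\dots,a_k:A_k\}$ is a functional type for closed session types $A_0,\dots,A_k$ of any polarities; $\tau\to\sigma$ is a functional type for functional types $\tau,\sigma$. Interpretation. The negative and positive aspects $[\![A]\!]^-,[\![A]\!]^+$ (as functions of an environment in $[\![\Xi]\!]$, acting on objects and on morphisms) and the interpretation $[\![\tau]\!]$ are defined by $$\begin{aligned} &[\![\mathbf 1]\!]^-=\{\bot\}, && [\![\mathbf 1]\!]^+=\{*\}_\bot,\\ &[\![\alpha]\!]^{q}=\pi_\alpha, && [\![\rho\alpha.A]\!]^q=([\![\Xi,\alpha\vdash A]\!]^q)^\dagger,\\ &[\![\downarrow\! A]\!]^-=[\![A]\!]^-, && [\![\downarrow\! A]\!]^+=[\![A]\!]^+_\bot,\\ &[\![\uparrow\! A]\!]^-=[\![A]\!]^-_\bot, && [\![\uparrow\! A]\!]^+=[\![A]\!]^+,\\ &[\![\oplus\{l:A_l\}]\!]^-=\textstyle\prod_l[\![A_l]\!]^-,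 && [\![\oplus\{l:A_l\}]\!]^+=\textstyle\bigoplus_l[\![A_l]\!]^+_\bot,\\ &[\![\&\{l:A_l\}]\!]^-=\textstyle\bigoplus_l[\![A_l]\!]^-_\bot, && [\![\&\{l:A_l\}]\!]^+=\textstyle\prod_l[\![A_l]\!]^+,\\ &[\![A\otimes B]\!]^-=[\![A]\!]^-\times[\![B]\!]^-, && [\![A\otimes B]\!]^+=([\![A]\!]^+\times[\![B]\!]^+)_\bot,\\ &[\![A\multimap B]\!]^-=([\![A]\!]^+\times[\![B]\!]^-)_\bot, && [\![A\multimap B]\!]^+=[\![A]\!]^-\times[\![B]\!]^+,\\ &[\![\tau\wedge A]\!]^-=[\![A]\!]^-, && [\![\tau\wedge A]\!]^+=([\![\tau]\!]\times[\![A]\!]^+)_\bot,\\ &[\![\tau\supset A]\!]^-=([\![\tau]\!]\times[\![A]\!]^-)_\bot, && [\![\tau\supset A]\!]^+=[\![A]\!]^+, \end{aligned}$$ $[\![\tau\to\sigma]\!]=[\,[\![\tau]\!]\to_\bot[\![\sigma]\!]\,]$ and $[\![\{a_0:A_0\leftarrow a_i:A_i\}]\!]=\bigl[\prod_{i\ge1}[\![A_i]\!]^+\times[\![A_0]\!]^-\to\prod_{i\ge1}[\![A_i]\!]^-\times[\![A_0]\!]^+\bigr]_\bot$.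 Here, for $F$ on $[\![\Xi]\!]\times\mathbf S$, $F^\dagger$ sends $D$ to the set of all sequences $(x_n)$ with $x_n\in X_n$ that are compatible with the projections $X_{n+1}\to X_n$, ordered componentwise, where $X_0=\{\bot\}$ and $X_{n+1}=F(D,X_n)$, the projection $X_1\to X_0$ is the unique map, and the projection $X_{n+2}\to X_{n+1}$ is $F(D,-)$ applied to the projection $X_{n+1}\to X_n$; $F^\dagger$ acts on morphisms componentwise, by the maps $f_0=\mathrm{id}$, $f_{n+1}=F(f,f_n)$. Proposition (Functorial Interpretations are Well-Defined). For every well-formed open session type $\Xi\vdash A$, the aspects $[\![\Xi\vdash A]\!]^-$ and $[\![\Xi\vdash A]\!]^+$ are locally continuous functors from $[\![\Xi]\!]$ to $\mathbf S$. Moreover, recursive types are interpreted as parametrized canonical fixed points of locally continuous functors: for $q\in\{-,+\}$, $F=[\![\Xi,\alpha\vdash A]\!]^q:[\![\Xi]\!]\times\mathbf S\to\mathbf S$ and $G=[\![\Xi\vdash\rho\alpha.A]\!]^q:[\![\Xi]\!]\to\mathbf S$, there is a natural isomorphism $\mathrm{Fold}:F\circ\langle\mathrm{id},G\rangle\Rightarrow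 G$ such that for every $D$, $G(D)$ is the bilimit of the $\omega$-chain of embedding-projection pairs $\{\bot\}\to H\{\bot\}\to H^2\{\bot\}\to\cdots$ with $H=F(D,-)$, and $\mathrm{Fold}_D$ is the canonical isomorphism: the embeddings $e_n:H^n\{\bot\}\to G(D)$ and projections $r_n$ of the bilimit satisfy $\mathrm{Fold}_D\circ H(e_n)=e_{n+1}$ and $r_{n+1}\circ\mathrm{Fold}_D=H(r_n)$. -/

import Mathlib

open CategoryTheory

universe u v w

namespace SessionTypes

/-! ## Scott domains -/

/-- Scott domains: `ω`-algebraic bounded-complete pointed dcpos (the least element is `⊥`). -/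
structure IsScottDomain (D : Type u) [PartialOrder D] [OrderBot D] : Prop where
  /-- Every nonempty directed set has a least upper bound. -/
  dcpo : ∀ d : Set D, d.Nonempty → DirectedOn (· ≤ ·) d → ∃ a, IsLUB d a
  /-- Every set with an upper bound has a least upper bound. -/
  boundedComplete : ∀ s : Set D, BddAbove s → ∃ a, IsLUB s a
  /-- There are countably many compact elements. -/
  countable_compact : {k : D | IsCompactElement k}.Countable
  /-- The compact elements below `x` form a directed set. -/
  directed_compact : ∀ x : D, DirectedOn (· ≤ ·) {k : D | IsCompactElement k ∧ k ≤ x}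
  /-- Every element is the least upper bound of the compact elements below it. -/
  isLUB_compact : ∀ x : D, IsLUB {k : D | IsCompactElement k ∧ k ≤ x} x

/-! ## Pointed posets and strict monotone maps

The semantic operations are given by explicit formulas on underlying sets, which make sense for
all pointed posets and strict monotone maps.  They are defined in this generality; that they
restrict to Scott domains and strict continuous maps, and are locally continuous there, is
something to be proved. -/

/-- A pointed partially ordered set. -/
structure PPos : Type (u + 1) where
  /-- The underlying set. -/
  carrier : Type u
  [order : PartialOrder carrier]
  [bot : OrderBot carrier]

instance : CoeSort PPos.{u} (Type u) := ⟨PPos.carrier⟩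
instance (X : PPos.{u}) : PartialOrder X := X.order
instance (X : PPos.{u}) : OrderBot X := X.bot

/-- Strict monotone maps. -/
@[ext]
structure PPos.Hom (X Y : PPos.{u}) : Type u where
  /-- The underlying function. -/
  toFun : X → Y
  mono : Monotone toFun
  strict : toFun ⊥ = ⊥

instance : Category PPos.{u} where
  Hom := PPos.Hom
  id X := ⟨fun x => x, fun _ _ h => h, rfl⟩
  comp f g := ⟨fun x => g.toFun (f.toFun x), fun _ _ h => g.mono (f.mono h), by
    rw [f.strict, g.strict]⟩

namespace PPos

@[ext]
theorem hom_ext {X Y : PPos.{u}} {f g : X ⟶ Y} (h : ∀ x, f.toFun x = g.toFun x) : f = g :=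
  PPos.Hom.ext (funext h)

@[simp]
theorem id_toFun (X : PPos.{u}) (x : X) : (𝟙 X : X ⟶ X).toFun x = x := rfl

@[simp]
theorem comp_toFun {X Y Z : PPos.{u}} (f : X ⟶ Y) (g : Y ⟶ Z) (x : X) :
    (f ≫ g).toFun x = g.toFun (f.toFun x) := rfl

/-- The one-point domain `{⊥}`. -/
def one : PPos.{u} := ⟨PUnit⟩

/-- The two-element domain `{∗}_⊥`. -/
def two : PPos.{u} := ⟨WithBot PUnit⟩

/-- The constant map with value `⊥`. -/
def botHom (X Y : PPos.{u}) : X ⟶ Y where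
  toFun _ := ⊥
  mono _ _ _ := le_rfl
  strict := rfl

/-- Lifting: `D ↦ D_⊥`, with `f_⊥ ⊥ = ⊥` and `f_⊥ (up d) = up (f d)`. -/
def lift : PPos.{u} ⥤ PPos.{u} where
  obj X := ⟨WithBot X⟩
  map f := ⟨WithBot.map f.toFun, f.mono.withBot_map, rfl⟩
  map_id X := by ext x; cases x <;> rfl
  map_comp f g := by ext x; cases x <;> rfl

/-- The binary product. -/
def prod : PPos.{u} × PPos.{u} ⥤ PPos.{u} where
  obj X := ⟨X.1 × X.2⟩
  map f := ⟨fun x => (f.1.toFun x.1, f.2.toFun x.2),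
    fun _ _ h => ⟨f.1.mono h.1, f.2.mono h.2⟩, Prod.ext f.1.strict f.2.strict⟩
  map_id _ := rfl
  map_comp _ _ := rfl

/-- The product of an indexed family. -/
def pi (L : Type) : (L → PPos.{u}) ⥤ PPos.{u} where
  obj X := ⟨∀ l, X l⟩
  map f := ⟨fun x l => (f l).toFun (x l), fun _ _ h l => (f l).mono (h l),
    funext fun l => (f l).strict⟩
  map_id _ := rfl
  map_comp _ _ := rfl

/-- The underlying set of the coalesced sum: `⊥` together with the pairs `(l, x)`, where `x` is a
non-bottom element of the `l`-th summand.  Pairs with distinct tags are incomparable. -/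
abbrev CSum {L : Type} (X : L → PPos.{u}) : Type u := WithBot (Σ l, {x : X l // x ≠ ⊥})

open Classical in
/-- The canonical injection of a summand into the coalesced sum. -/
noncomputable def CSum.inj {L : Type} {X : L → PPos.{u}} (l : L) (x : X l) : CSum X :=
  if h : x = ⊥ then ⊥ else ((⟨l, ⟨x, h⟩⟩ : Σ l, {x : X l // x ≠ ⊥}) : CSum X)

/-- The action of the coalesced sum on maps: `⊥ ↦ ⊥` and `(l, x) ↦ (l, f_l x)`, where the latter
is identified with `⊥` if `f_l x = ⊥`. -/
noncomputable def CSum.map {L : Type} {X Y : L → PPos.{u}} (f : ∀ l, X l ⟶ Y l) :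
    CSum X → CSum Y :=
  WithBot.recBotCoe ⊥ fun a => CSum.inj a.1 ((f a.1).toFun a.2.1)

theorem CSum.inj_bot {L : Type} {X : L → PPos.{u}} (l : L) :
    CSum.inj l (⊥ : X l) = (⊥ : CSum X) := by simp [CSum.inj]

theorem CSum.inj_mono {L : Type} {X : L → PPos.{u}} (l : L) {x y : X l} (h : x ≤ y) :
    (CSum.inj l x : CSum X) ≤ CSum.inj l y := by
  by_cases hx : x = ⊥
  · subst hx; rw [CSum.inj_bot]; exact bot_le
  · have hy : y ≠ ⊥ := fun hy => hx (le_bot_iff.1 (hy ▸ h))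
    rw [CSum.inj, CSum.inj, dif_neg hx, dif_neg hy, WithBot.coe_le_coe]
    exact Sigma.LE.fiber l _ _ h

theorem CSum.map_inj {L : Type} {X Y : L → PPos.{u}} (f : ∀ l, X l ⟶ Y l) (l : L) (x : X l) :
    CSum.map f (CSum.inj l x) = CSum.inj l ((f l).toFun x) := by
  by_cases hx : x = ⊥
  · subst hx; rw [CSum.inj_bot, (f l).strict, CSum.inj_bot]; rfl
  · rw [CSum.inj, dif_neg hx]; rfl

/-- The coalesced sum of an indexed family. -/
noncomputable def sum (L : Type) : (L → PPos.{u}) ⥤ PPos.{u} where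
  obj X := ⟨CSum X⟩
  map f := ⟨CSum.map f, by
    intro a b h
    induction a using WithBot.recBotCoe with
    | bot => exact bot_le
    | coe a =>
      induction b using WithBot.recBotCoe with
      | bot => exact absurd h (WithBot.not_coe_le_bot a)
      | coe b =>
        rw [WithBot.coe_le_coe] at h
        cases h with
        | fiber l _ _ h => exact CSum.inj_mono l ((f l).mono h), rfl⟩
  map_id X := by
    ext a
    induction a using WithBot.recBotCoe with
    | bot => rfl
    | coe a => exact dif_neg a.2.2
  map_comp f g := by
    ext a
    induction a using WithBot.recBotCoe with
    | bot => rfl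
    | coe a => exact (CSum.map_inj g _ _).symm

/-- The function space `[X → Y]` of all continuous functions, ordered pointwise. -/
def cfun (X Y : PPos.{u}) : PPos.{u} where
  carrier := {f : X → Y // ScottContinuous f}
  bot := { bot := ⟨fun _ => ⊥, ScottContinuous.const ⊥⟩, bot_le := fun _ _ => bot_le }

/-- The function space of all strict continuous functions, ordered pointwise. -/
def sfun (X Y : PPos.{u}) : PPos.{u} where
  carrier := {f : X → Y // ScottContinuous f ∧ f ⊥ = ⊥}
  bot := { bot := ⟨fun _ => ⊥, ScottContinuous.const ⊥, rfl⟩, bot_le := fun _ _ => bot_le }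

/-! ### The canonical fixed point

For `F : C × PPos ⥤ PPos` and `c : C`, put `X₀ = {⊥}` and `X_{n+1} = F (c, X_n)`.  The projections
`X_{n+1} ⟶ X_n` are the unique map for `n = 0` and are then obtained by applying `F (c, -)`.  The
bilimit of this `ω`-chain is the set of all threads `(x_n)` with `x_n` the projection of
`x_{n+1}`. -/

section Fix

variable {C : Type v} [Category.{w} C] (F : C × PPos.{u} ⥤ PPos.{u})

/-- The objects `X_n`. -/
def fixObj (c : C) : ℕ → PPos.{u}
  | 0 => one
  | n + 1 => F.obj (c, fixObj c n)

/-- The projections `X_{n+1} ⟶ X_n`. -/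
def fixProj (c : C) : ∀ n, fixObj F c (n + 1) ⟶ fixObj F c n
  | 0 => botHom _ _
  | n + 1 => F.map (Prod.mkHom (𝟙 c) (fixProj c n))

/-- The maps between the chains for `c` and `d` induced by `f : c ⟶ d`. -/
def fixMap {c d : C} (f : c ⟶ d) : ∀ n, fixObj F c n ⟶ fixObj F d n
  | 0 => botHom _ _
  | n + 1 => F.map (Prod.mkHom f (fixMap f n))

theorem fixMap_id (c : C) : ∀ n, fixMap F (𝟙 c) n = 𝟙 (fixObj F c n)
  | 0 => rfl
  | n + 1 => (congrArg (fun g => F.map (Prod.mkHom (𝟙 c) g)) (fixMap_id c n)).trans (F.map_id _)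

theorem fixMap_comp {c d e : C} (f : c ⟶ d) (g : d ⟶ e) :
    ∀ n, fixMap F (f ≫ g) n = fixMap F f n ≫ fixMap F g n
  | 0 => rfl
  | n + 1 => (congrArg (fun k => F.map (Prod.mkHom (f ≫ g) k)) (fixMap_comp f g n)).trans
      (F.map_comp (Prod.mkHom f (fixMap F f n)) (Prod.mkHom g (fixMap F g n)))

theorem fixMap_proj {c d : C} (f : c ⟶ d) :
    ∀ n, fixMap F f (n + 1) ≫ fixProj F d n = fixProj F c n ≫ fixMap F f n
  | 0 => rfl
  | n + 1 => by
    refine (F.map_comp (Prod.mkHom f (fixMap F f (n + 1)))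
      (Prod.mkHom (𝟙 d) (fixProj F d n))).symm.trans
      (Eq.trans (congrArg F.map (Prod.ext ?_ (fixMap_proj f n)))
        (F.map_comp (Prod.mkHom (𝟙 c) (fixProj F c n)) (Prod.mkHom f (fixMap F f n))))
    exact (Category.comp_id f).trans (Category.id_comp f).symm

/-- The parametrized fixed point functor `F† : C ⥤ PPos`, sending `c` to the canonical fixed point
of `F (c, -)`. -/
def dagger : C ⥤ PPos.{u} where
  obj c :=
    { carrier := {x : ∀ n, fixObj F c n // ∀ n, (fixProj F c n).toFun (x (n + 1)) = x n}
      bot :=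
        { bot := ⟨fun _ => ⊥, fun n => (fixProj F c n).strict⟩
          bot_le := fun _ _ => bot_le } }
  map {c d} f :=
    { toFun := fun x => ⟨fun n => (fixMap F f n).toFun (x.1 n), fun n => by
        rw [← comp_toFun, fixMap_proj, comp_toFun, x.2 n]⟩
      mono := fun _ _ h n => (fixMap F f n).mono (h n)
      strict := Subtype.ext (funext fun n => (fixMap F f n).strict) }
  map_id c := by
    refine hom_ext fun x => Subtype.ext (funext fun n => ?_)
    change (fixMap F (𝟙 c) n).toFun (x.1 n) = x.1 n
    rw [fixMap_id]; rfl
  map_comp f g := by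
    refine hom_ext fun x => Subtype.ext (funext fun n => ?_)
    change (fixMap F (f ≫ g) n).toFun (x.1 n) = (fixMap F g n).toFun ((fixMap F f n).toFun (x.1 n))
    rw [fixMap_comp]; rfl

end Fix

end PPos

/-- The functor `C^n × C ⥤ C^(n+1)` that extends an environment by a value for the most recently
bound variable, which has index `0`. -/
def extend (C : Type v) [Category.{w} C] (n : ℕ) : (Fin n → C) × C ⥤ (Fin (n + 1) → C) where
  obj X := Fin.cons X.2 X.1
  map {X Y} f := Fin.cons
    (α := fun i => (Fin.cons X.2 X.1 : Fin (n + 1) → C) i ⟶ (Fin.cons Y.2 Y.1 : Fin (n + 1) → C) i)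
    f.2 f.1
  map_id X := by funext i; refine Fin.cases ?_ (fun i => ?_) i <;> rfl
  map_comp f g := by funext i; refine Fin.cases ?_ (fun i => ?_) i <;> rfl

/-! ## Session types -/

/-- Polarities. -/
inductive Polarity : Type
  | neg
  | pos

mutual

/-- Derivations of `Ξ ⊢ A type_s^p`: the open session types `A` of polarity `p` over a context `Ξ`
of `n` polarized type variables (given by their indices), with choice labels in `Label`. -/
inductive SType (Label : Type) : {n : ℕ} → (Fin n → Polarity) → Polarity → Type
  /-- The unit type `1`. -/
  | unit {n : ℕ} {Ξ : Fin n → Polarity} : SType Label Ξ .pos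
  /-- Type variables. -/
  | var {n : ℕ} {Ξ : Fin n → Polarity} {p : Polarity} (α : Fin n) (h : Ξ α = p) : SType Label Ξ p
  /-- Recursive types `ρα.A`. -/
  | recur {n : ℕ} {Ξ : Fin n → Polarity} {p : Polarity}
      (A : SType Label (Fin.cons p Ξ : Fin (n + 1) → Polarity) p) : SType Label Ξ p
  /-- Downshifts. -/
  | down {n : ℕ} {Ξ : Fin n → Polarity} (A : SType Label Ξ .neg) : SType Label Ξ .pos
  /-- Upshifts. -/
  | up {n : ℕ} {Ξ : Fin n → Polarity} (A : SType Label Ξ .pos) : SType Label Ξ .neg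
  /-- Internal choice `⊕{l : A_l}`, `l ∈ L`. -/
  | plus {n : ℕ} {Ξ : Fin n → Polarity} (L : Finset Label) (A : {l // l ∈ L} → SType Label Ξ .pos) :
      SType Label Ξ .pos
  /-- External choice `&{l : A_l}`, `l ∈ L`. -/
  | amp {n : ℕ} {Ξ : Fin n → Polarity} (L : Finset Label) (A : {l // l ∈ L} → SType Label Ξ .neg) :
      SType Label Ξ .neg
  /-- Channel transmission `A ⊗ B`. -/
  | tensor {n : ℕ} {Ξ : Fin n → Polarity} (A B : SType Label Ξ .pos) : SType Label Ξ .pos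
  /-- Channel reception `A ⊸ B`. -/
  | lolly {n : ℕ} {Ξ : Fin n → Polarity} (A : SType Label Ξ .pos) (B : SType Label Ξ .neg) :
      SType Label Ξ .neg
  /-- Value transmission `τ ∧ A`. -/
  | and {n : ℕ} {Ξ : Fin n → Polarity} (τ : FType Label) (A : SType Label Ξ .pos) :
      SType Label Ξ .pos
  /-- Value reception `τ ⊃ A`. -/
  | imp {n : ℕ} {Ξ : Fin n → Polarity} (τ : FType Label) (A : SType Label Ξ .neg) :
      SType Label Ξ .neg

/-- Derivations of `τ type_f`: functional types. -/
inductive FType (Label : Type) : Type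
  /-- Quoted processes `{a₀ : A₀ ← a₁ : A₁, …, a_k : A_k}`; the channels are given by position. -/
  | quoted {p : Polarity} (A₀ : SType Label (Fin.elim0 : Fin 0 → Polarity) p) (k : ℕ)
      (ps : Fin k → Polarity)
      (A : ∀ i, SType Label (Fin.elim0 : Fin 0 → Polarity) (ps i)) : FType Label
  /-- Function types `τ → σ`. -/
  | arrow (τ σ : FType Label) : FType Label

end

mutual

/-- The negative (`q = neg`) and positive (`q = pos`) aspects `⟦Ξ ⊢ A⟧^q`. -/
noncomputable def SType.interp {Label : Type} : {n : ℕ} → {Ξ : Fin n → Polarity} → {p : Polarity} →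
    SType Label Ξ p → (q : Polarity) → ((Fin n → PPos.{u}) ⥤ PPos.{u})
  | _, _, _, .unit, .neg => (Functor.const _).obj PPos.one
  | _, _, _, .unit, .pos => (Functor.const _).obj PPos.two
  | _, _, _, .var α _, _ => Pi.eval _ α
  | n, _, _, .recur A, q => PPos.dagger (extend PPos.{u} n ⋙ A.interp q)
  | _, _, _, .down A, .neg => A.interp .neg
  | _, _, _, .down A, .pos => A.interp .pos ⋙ PPos.lift
  | _, _, _, .up A, .neg => A.interp .neg ⋙ PPos.lift
  | _, _, _, .up A, .pos => A.interp .pos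
  | _, _, _, .plus L A, .neg => Functor.pi' (fun l => (A l).interp .neg) ⋙ PPos.pi {l // l ∈ L}
  | _, _, _, .plus L A, .pos =>
      Functor.pi' (fun l => (A l).interp .pos ⋙ PPos.lift) ⋙ PPos.sum {l // l ∈ L}
  | _, _, _, .amp L A, .neg =>
      Functor.pi' (fun l => (A l).interp .neg ⋙ PPos.lift) ⋙ PPos.sum {l // l ∈ L}
  | _, _, _, .amp L A, .pos => Functor.pi' (fun l => (A l).interp .pos) ⋙ PPos.pi {l // l ∈ L}
  | _, _, _, .tensor A B, .neg => (A.interp .neg).prod' (B.interp .neg) ⋙ PPos.prod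
  | _, _, _, .tensor A B, .pos => (A.interp .pos).prod' (B.interp .pos) ⋙ PPos.prod ⋙ PPos.lift
  | _, _, _, .lolly A B, .neg => (A.interp .pos).prod' (B.interp .neg) ⋙ PPos.prod ⋙ PPos.lift
  | _, _, _, .lolly A B, .pos => (A.interp .neg).prod' (B.interp .pos) ⋙ PPos.prod
  | _, _, _, .and _ A, .neg => A.interp .neg
  | _, _, _, .and τ A, .pos =>
      ((Functor.const _).obj τ.interp).prod' (A.interp .pos) ⋙ PPos.prod ⋙ PPos.lift
  | _, _, _, .imp τ A, .neg =>
      ((Functor.const _).obj τ.interp).prod' (A.interp .neg) ⋙ PPos.prod ⋙ PPos.lift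
  | _, _, _, .imp _ A, .pos => A.interp .pos

/-- The interpretation `⟦τ⟧` of a functional type.  A type of quoted processes denotes the lifting of
`[∏ᵢ⟦A_i⟧⁺ × ⟦A₀⟧⁻ → ∏ᵢ⟦A_i⟧⁻ × ⟦A₀⟧⁺]`. -/
noncomputable def FType.interp {Label : Type} : FType Label → PPos.{u}
  | .quoted A₀ k _ A => PPos.lift.obj (PPos.cfun
      (PPos.prod.obj ((PPos.pi (Fin k)).obj (fun i => ((A i).interp .pos).obj (fun j => j.elim0)),
        (A₀.interp .neg).obj (fun j => j.elim0)))
      (PPos.prod.obj ((PPos.pi (Fin k)).obj (fun i => ((A i).interp .neg).obj (fun j => j.elim0)),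
        (A₀.interp .pos).obj (fun j => j.elim0))))
  | .arrow τ σ => PPos.sfun τ.interp σ.interp

end

/-! ## The category of Scott domains and strict continuous maps -/

/-- A (bundled) Scott domain. -/
structure SDom : Type (u + 1) where
  /-- The underlying pointed poset. -/
  toPPos : PPos.{u}
  isScott : IsScottDomain toPPos

/-- Strict continuous maps. -/
@[ext]
structure SDom.Hom (X Y : SDom.{u}) : Type u where
  /-- The underlying strict monotone map. -/
  toHom : X.toPPos ⟶ Y.toPPos
  cont : ScottContinuous toHom.toFun

instance : Category SDom.{u} where
  Hom := SDom.Hom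
  id X := ⟨𝟙 X.toPPos, ScottContinuous.id⟩
  comp f g := ⟨f.toHom ≫ g.toHom, f.cont.comp g.cont⟩

namespace SDom

@[ext]
theorem hom_ext {X Y : SDom.{u}} {f g : X ⟶ Y} (h : f.toHom = g.toHom) : f = g :=
  SDom.Hom.ext h

/-- The one-point Scott domain. -/
def one : SDom.{u} where
  toPPos := PPos.one
  isScott :=
    { dcpo := fun _ _ _ => ⟨PUnit.unit, fun _ _ => le_rfl, fun _ _ => le_rfl⟩
      boundedComplete := fun _ _ => ⟨PUnit.unit, fun _ _ => le_rfl, fun _ _ => le_rfl⟩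
      countable_compact :=
        (Set.countable_singleton (PUnit.unit : PUnit.{u + 1})).mono fun _ _ => rfl
      directed_compact := fun _ a ha _ _ => ⟨a, ha, le_rfl, le_rfl⟩
      isLUB_compact := fun _ => ⟨fun _ h => h.2, fun _ _ => le_rfl⟩ }

/-- The constant map with value `⊥`. -/
def botHom (X Y : SDom.{u}) : X ⟶ Y :=
  ⟨PPos.botHom X.toPPos Y.toPPos, ScottContinuous.const ⊥⟩

end SDom

/-- Categories with partially ordered hom-sets. -/
class HomOrder (C : Type v) [Category.{w} C] where
  /-- The order on hom-sets. -/
  homOrder : ∀ X Y : C, PartialOrder (X ⟶ Y)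

attribute [instance, reducible] HomOrder.homOrder

/-- Strict continuous maps are ordered pointwise. -/
instance : HomOrder SDom.{u} where
  homOrder _ _ :=
    { le := fun f g => ∀ x, f.toHom.toFun x ≤ g.toHom.toFun x
      le_refl := fun _ _ => le_rfl
      le_trans := fun _ _ _ h h' x => (h x).trans (h' x)
      le_antisymm := fun _ _ h h' =>
        SDom.hom_ext (PPos.hom_ext fun x => le_antisymm (h x) (h' x)) }

/-- The hom-sets of an indexed product of categories are ordered componentwise. -/
instance {I : Type} (C : Type v) [Category.{w} C] [HomOrder C] : HomOrder (I → C) where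
  homOrder X Y := inferInstanceAs (PartialOrder (∀ i, X i ⟶ Y i))

/-- A functor is locally continuous if its action on each hom-set is Scott-continuous. -/
def IsLocallyContinuous {C : Type v} [Category.{w} C] [HomOrder C] (F : C ⥤ SDom.{u}) : Prop :=
  ∀ X Y : C, ScottContinuous (fun f : X ⟶ Y => F.map f)

/-- A functor on pointed posets sends Scott domains to Scott domains, and strict continuous maps
between them to strict continuous maps. -/
structure PreservesScott {n : ℕ} (P : (Fin n → PPos.{u}) ⥤ PPos.{u}) : Prop where
  obj : ∀ D : Fin n → SDom.{u}, IsScottDomain (P.obj fun i => (D i).toPPos)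
  map : ∀ (D E : Fin n → SDom.{u}) (f : ∀ i, D i ⟶ E i),
    ScottContinuous
      (P.map (fun i => (f i).toHom :
        (fun i => (D i).toPPos : Fin n → PPos.{u}) ⟶ (fun i => (E i).toPPos))).toFun

/-- The induced functor on Scott domains and strict continuous maps; it has the same underlying
objects and maps. -/
def PreservesScott.functor {n : ℕ} {P : (Fin n → PPos.{u}) ⥤ PPos.{u}} (h : PreservesScott P) :
    (Fin n → SDom.{u}) ⥤ SDom.{u} where
  obj D := ⟨P.obj fun i => (D i).toPPos, h.obj D⟩
  map {D E} f := ⟨P.map (fun i => (f i).toHom :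
        (fun i => (D i).toPPos : Fin n → PPos.{u}) ⟶ (fun i => (E i).toPPos)), h.map D E f⟩
  map_id _ := SDom.hom_ext (P.map_id _)
  map_comp _ _ := SDom.hom_ext (P.map_comp _ _)

/-! ## Canonical fixed points of functors on Scott domains -/

namespace SDom

section

variable (H : SDom.{u} ⥤ SDom.{u})

/-- The iterates `H^n {⊥}`. -/
def iter : ℕ → SDom.{u}
  | 0 => one
  | n + 1 => H.obj (iter n)

/-- The embeddings `H^n {⊥} ⟶ H^(n+1) {⊥}`. -/
def iterEmb : ∀ n, iter H n ⟶ iter H (n + 1)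
  | 0 => botHom _ _
  | n + 1 => H.map (iterEmb n)

/-- The projections `H^(n+1) {⊥} ⟶ H^n {⊥}`. -/
def iterProj : ∀ n, iter H (n + 1) ⟶ iter H n
  | 0 => botHom _ _
  | n + 1 => H.map (iterProj n)

/-- `X`, with the isomorphism `fold : H X ≅ X`, is the canonical fixed point of `H`: it is the bilimit
of the `ω`-chain `{⊥} ⟶ H {⊥} ⟶ H² {⊥} ⟶ ⋯` of embedding-projection pairs, and `fold` is the
induced comparison isomorphism. -/
def IsCanonicalFixedPoint (X : SDom.{u}) (fold : H.obj X ≅ X) : Prop :=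
  ∃ (e : ∀ n, iter H n ⟶ X) (r : ∀ n, X ⟶ iter H n),
    (∀ n, iterEmb H n ≫ e (n + 1) = e n) ∧
    (∀ n, r (n + 1) ≫ iterProj H n = r n) ∧
    (∀ n, e n ≫ r n = 𝟙 (iter H n)) ∧
    IsLUB (Set.range fun n => r n ≫ e n) (𝟙 X) ∧
    (∀ n, H.map (e n) ≫ fold.hom = e (n + 1)) ∧
    (∀ n, fold.hom ≫ r (n + 1) = H.map (r n))

end

/-- `G : C ⥤ SDom` is the parametrized canonical fixed point of `F : C × SDom ⥤ SDom`: there is a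
natural isomorphism `Fold : F ∘ ⟨id, G⟩ ≅ G` whose component at each `c` exhibits `G c` as the
canonical fixed point of `F (c, -)`. -/
def IsParamFixedPoint {C : Type v} [Category.{w} C] (F : C × SDom.{u} ⥤ SDom.{u})
    (G : C ⥤ SDom.{u}) : Prop :=
  ∃ Fold : (𝟭 C).prod' G ⋙ F ≅ G,
    ∀ c : C, IsCanonicalFixedPoint (Prod.sectR c SDom.{u} ⋙ F) (G.obj c) (Fold.app c)

end SDom

end SessionTypes

universe v₁ w₁ v₂ w₂

namespace SessionTypes

-- Order theory: bases of compact elements, adjunctions and continuity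

section Order

variable {D : Type*} [PartialOrder D]

-- The first claim is proved by structural induction on types with the invariant `IsDomFunctor`: a
-- functor between categories built from pointed posets sends domains to domains and continuous maps
-- to continuous maps, is monotone on hom-sets, and preserves pointwise suprema of directed sets of
-- continuous maps. The invariant is closed under composition and tupling, and it holds for the
-- basic constructors and for `dagger`. Functional types occur only as constants, so for them it is
-- enough, in the same induction, that they denote Scott domains.
--
-- Most constructions are shown to be Scott domains by `IsScottDomain.of_family`: countably many
-- Scott domains embed by maps with continuous upper adjoints, and every element is the join of its
-- approximations. The embeddings are injections for products and coalesced sums, step functions for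
-- function spaces (the adjoint being evaluation at a compact point), and the stages of the chain
-- for the bilimit. Lifting is treated directly with `IsScottDomain.of_base`.
--
-- For the bilimit of `H = F (c, -)`, the idempotent `e_n ∘ r_n` fixes the components up to `n` of
-- every thread, so these idempotents have supremum the identity. The structure map has components
-- `H r_n`, and its inverse is the supremum of `H e_n ∘ r_{n+1}`; local continuity turns `sup H (e_n
-- ∘ r_n)` into `H id = id`.
--
-- Over Scott domains, any fixed point has recursively defined embeddings and projections that
-- satisfy all the required equations. It is therefore canonical as soon as its idempotents have
-- supremum the identity, and this again follows from the fact that the `n`-th one fixes the `n`-th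
-- component.

theorem exists_upper_bound_mem_of_finite {s t : Set D} (hs : s.Nonempty)
    (hd : DirectedOn (· ≤ ·) s) (ht : t.Finite) (h : ∀ b ∈ t, ∃ x ∈ s, b ≤ x) :
    ∃ x ∈ s, ∀ b ∈ t, b ≤ x := by
  induction t, ht using Set.Finite.induction_on with
  | empty => exact ⟨hs.some, hs.some_mem, by simp⟩
  | @insert a t _ _ ih =>
    obtain ⟨x, hx, hxt⟩ := ih fun b hb => h b (Set.mem_insert_of_mem _ hb)
    obtain ⟨y, hy, hay⟩ := h a (Set.mem_insert _ _)
    obtain ⟨z, hz, hxz, hyz⟩ := hd x hx y hy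
    refine ⟨z, hz, ?_⟩
    rintro b (rfl | hb)
    exacts [hay.trans hyz, (hxt b hb).trans hxz]

/-- Finite joins of compact elements are compact. -/
theorem isCompactElement_of_isLUB {t : Set D} (ht : t.Finite) (hc : ∀ b ∈ t, IsCompactElement b)
    {k : D} (hk : IsLUB t k) : IsCompactElement k := by
  intro s u hs hd hu hku
  obtain ⟨x, hx, h⟩ := exists_upper_bound_mem_of_finite hs hd ht
    fun b hb => hc b hb s u hs hd hu ((hk.1 hb).trans hku)
  exact ⟨x, hx, hk.2 h⟩

/-- A bounded-complete pointed dcpo with a countable base of compact elements is a Scott domain. -/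
theorem IsScottDomain.of_base [OrderBot D]
    (dcpo : ∀ d : Set D, d.Nonempty → DirectedOn (· ≤ ·) d → ∃ a, IsLUB d a)
    (bc : ∀ s : Set D, BddAbove s → ∃ a, IsLUB s a) (B : Set D) (hB : B.Countable)
    (hc : ∀ b ∈ B, IsCompactElement b) (hl : ∀ x, IsLUB {b | b ∈ B ∧ b ≤ x} x) :
    IsScottDomain D := by
  have key : ∀ k : D, IsCompactElement k → ∃ t : Set D, (t.Finite ∧ t ⊆ B) ∧ IsLUB t k := by
    intro k hk
    -- The joins of finite sets of base elements below `k` are directed with supremum `k`, so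
    -- compactness forces `k` to be one of them.
    let s : Set D := {j | ∃ t : Set D, (t.Finite ∧ t ⊆ B) ∧ (∀ b ∈ t, b ≤ k) ∧ IsLUB t j}
    have hs : s.Nonempty := ⟨⊥, ∅, by simp, by simp, by simp⟩
    have hd : DirectedOn (· ≤ ·) s := by
      rintro i ⟨t, ht, htk, hi⟩ j ⟨t', ht', htk', hj⟩
      have hu : ∀ b ∈ t ∪ t', b ≤ k := by
        rintro b (hb | hb)
        exacts [htk b hb, htk' b hb]
      obtain ⟨l, hl⟩ := bc (t ∪ t') ⟨k, hu⟩
      exact ⟨l, ⟨_, ⟨ht.1.union ht'.1, Set.union_subset ht.2 ht'.2⟩, hu, hl⟩,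
        hi.2 fun b hb => hl.1 (Or.inl hb), hj.2 fun b hb => hl.1 (Or.inr hb)⟩
    have hlub : IsLUB s k := by
      refine ⟨?_, fun u hu => (hl k).2 fun b hb => ?_⟩
      · rintro j ⟨t, -, htk, hj⟩
        exact hj.2 htk
      · exact hu ⟨{b}, ⟨Set.finite_singleton b, by simpa using hb.1⟩, by simpa using hb.2,
          isLUB_singleton⟩
    obtain ⟨j, ⟨t, ht, htk, hj⟩, hkj⟩ := hk s k hs hd hlub le_rfl
    exact ⟨t, ht, le_antisymm hkj (hj.2 htk) ▸ hj⟩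
  refine ⟨dcpo, bc, ?_, ?_, ?_⟩
  · choose! f hf using key
    -- A compact element is recovered as the join of its chosen finite subset of `B`, and a
    -- countable set has countably many finite subsets.
    refine Set.MapsTo.countable_of_injOn (f := f) (t := {t : Set D | t.Finite ∧ t ⊆ B})
      (fun k hk => (hf k hk).1) ?_ (Set.countable_ofPred_finite_subset hB)
    intro k hk k' hk' h
    have h1 := (hf k hk).2
    rw [h] at h1
    exact h1.unique (hf k' hk').2
  · rintro x i ⟨hi, hix⟩ j ⟨hj, hjx⟩
    have hu : ∀ b ∈ ({i, j} : Set D), b ≤ x := by simp [hix, hjx]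
    obtain ⟨l, hl⟩ := bc {i, j} ⟨x, hu⟩
    refine ⟨l, ⟨isCompactElement_of_isLUB (Set.toFinite {i, j}) ?_ hl, hl.2 hu⟩,
      hl.1 (by simp), hl.1 (by simp)⟩
    simp [hi, hj]
  · exact fun x => ⟨fun _ h => h.2, fun u hu => (hl x).2 fun b hb => hu ⟨hc b hb.1, hb.2⟩⟩

theorem directedOn_image_of_monotone {X Y : Type*} [Preorder X] [Preorder Y] {f : X → Y}
    (hf : Monotone f) {d : Set X} (hd : DirectedOn (· ≤ ·) d) : DirectedOn (· ≤ ·) (f '' d) := by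
  rintro _ ⟨x, hx, rfl⟩ _ ⟨y, hy, rfl⟩
  obtain ⟨z, hz, hxz, hyz⟩ := hd x hx y hy
  exact ⟨f z, ⟨z, hz, rfl⟩, hf hxz, hf hyz⟩

/-- The lower adjoint of a Scott-continuous map preserves compact elements. -/
theorem isCompactElement_of_gc {E : Type*} [PartialOrder E] {l : E → D} {r : D → E}
    (gc : GaloisConnection l r) (hr : ScottContinuous r) {k : E} (hk : IsCompactElement k) :
    IsCompactElement (l k) := by
  intro s u hs hd hu hku
  obtain ⟨_, ⟨x, hx, rfl⟩, h⟩ := hk (r '' s) (r u) (hs.image r) 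
      (directedOn_image_of_monotone hr.monotone hd)
    (hr hs hd hu) (gc.le_iff_le.1 hku)
  exact ⟨x, hx, gc.le_iff_le.2 h⟩

/-- A bounded-complete pointed dcpo that is the join of countably many Scott domains, each embedded
with a Scott-continuous upper adjoint, is a Scott domain. -/
theorem IsScottDomain.of_family [OrderBot D] {ι : Type*} [Countable ι] {Z : ι → PPos.{u}}
    (hZ : ∀ i, IsScottDomain (Z i)) (l : ∀ i, Z i → D) (r : ∀ i, D → Z i)
    (gc : ∀ i, GaloisConnection (l i) (r i)) (hr : ∀ i, ScottContinuous (r i))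
    (hl : ∀ x, IsLUB (Set.range fun i => l i (r i x)) x)
    (dcpo : ∀ d : Set D, d.Nonempty → DirectedOn (· ≤ ·) d → ∃ a, IsLUB d a)
    (bc : ∀ s : Set D, BddAbove s → ∃ a, IsLUB s a) : IsScottDomain D := by
  refine .of_base dcpo bc (⋃ i, l i '' {k | IsCompactElement k})
    (Set.countable_iUnion fun i => ((hZ i).countable_compact).image _) ?_ ?_
  · intro b hb
    obtain ⟨i, k, hk, rfl⟩ := Set.mem_iUnion.1 hb
    exact isCompactElement_of_gc (gc i) (hr i) hk
  · refine fun x => ⟨fun _ h => h.2, fun u hu => (hl x).2 ?_⟩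
    rintro _ ⟨i, rfl⟩
    refine ((gc i).isLUB_l_image ((hZ i).isLUB_compact (r i x))).2 ?_
    rintro _ ⟨k, ⟨hk, hkx⟩, rfl⟩
    exact hu ⟨Set.mem_iUnion.2 ⟨i, k, hk, rfl⟩, (gc i).le_iff_le.2 hkx⟩

/-- This form of the supremum property lets an adjunction be rewritten inside each inequality. -/
theorem isLUB_range_iff {ι : Type*} {f : ι → D} {a : D} :
    IsLUB (Set.range f) a ↔ ∀ y, a ≤ y ↔ ∀ i, f i ≤ y := by
  rw [isLUB_iff_le_iff]
  simp [mem_upperBounds]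

theorem isLUB_image_iff {ι : Type*} {f : ι → D} {s : Set ι} {a : D} :
    IsLUB (f '' s) a ↔ ∀ y, a ≤ y ↔ ∀ i ∈ s, f i ≤ y := by
  rw [isLUB_iff_le_iff]
  simp [mem_upperBounds]

/-- A pointwise least upper bound of Scott-continuous functions is Scott-continuous. -/
theorem ScottContinuous.of_isLUB {X : Type*} [PartialOrder X] {S : Set (X → D)}
    (hS : ∀ f ∈ S, ScottContinuous f) {g : X → D}
    (hg : ∀ x, IsLUB ((fun f => f x) '' S) (g x)) : ScottContinuous g := by
  intro d hd hdd a ha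
  rw [isLUB_image_iff]
  intro y
  rw [isLUB_image_iff.1 (hg a) y]
  have h1 : ∀ f ∈ S, f a ≤ y ↔ ∀ x ∈ d, f x ≤ y :=
    fun f hf => isLUB_image_iff.1 (hS f hf hd hdd ha) y
  constructor
  · exact fun h x hx => (isLUB_image_iff.1 (hg x) y).2 fun f hf => (h1 f hf).1 (h f hf) x hx
  · exact fun h f hf => (h1 f hf).2 fun x hx => (isLUB_image_iff.1 (hg x) y).1 (h x hx) f hf

/-- Lower adjoints preserve all existing suprema, in particular directed ones. This gives continuity
of embeddings and of order isomorphisms. -/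
theorem _root_.GaloisConnection.scottContinuous {E : Type*} [PartialOrder E] {l : E → D} {r : D → E}
    (gc : GaloisConnection l r) : ScottContinuous l :=
  fun _ _ _ _ ha => gc.isLUB_l_image ha

theorem scottContinuous_pi {ι X : Type*} [PartialOrder X] {Y : ι → Type*}
    [∀ i, PartialOrder (Y i)] {f : X → ∀ i, Y i} (h : ∀ i, ScottContinuous fun x => f x i) :
    ScottContinuous f := by
  intro d hd hdd a ha
  refine isLUB_pi.2 fun i => ?_
  rw [Set.image_image]
  exact h i hd hdd ha

theorem scottContinuous_eval {ι : Type*} {Y : ι → Type*} [∀ i, PartialOrder (Y i)] (i : ι) :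
    ScottContinuous (Function.eval i : (∀ i, Y i) → Y i) :=
  fun _ _ _ _ ha => isLUB_pi.1 ha i

/-! ### Lifting -/

/-- Nonemptiness matters: the empty set has supremum the new bottom, not the image of an old one. -/
theorem isLUB_withBot_coe_image {s : Set D} (hs : s.Nonempty) {a : D} (ha : IsLUB s a) :
    IsLUB ((↑) '' s : Set (WithBot D)) (a : WithBot D) := by
  rw [isLUB_image_iff]
  intro y
  cases y with
  | bot => simp only [WithBot.not_coe_le_bot, false_iff]; exact fun h => h _ hs.some_mem
  | coe y => simp only [WithBot.coe_le_coe]; exact isLUB_iff_le_iff.1 ha y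

-- Case split behind every supremum in a lifting: either the supremum is the new bottom, or, since
-- `isLUB_diff_bot` allows the bottom to be discarded, it is computed in the original poset.
omit [PartialOrder D] in
theorem withBot_subset_or_diff_eq_image (s : Set (WithBot D)) :
    s ⊆ {⊥} ∨ ∃ s' : Set D, s'.Nonempty ∧ s \ {⊥} = (↑) '' s' := by
  by_cases h : s ⊆ {⊥}
  · exact .inl h
  · refine .inr ⟨{x | (x : WithBot D) ∈ s}, ?_, ?_⟩
    · obtain ⟨x, hx, hx'⟩ := Set.not_subset.1 h
      cases x with
      | bot => exact absurd rfl hx'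
      | coe x => exact ⟨x, hx⟩
    · ext x
      cases x <;> simp

theorem isLUB_diff_bot {E : Type*} [PartialOrder E] [OrderBot E] {s : Set E} {a : E} :
    IsLUB (s \ {⊥}) a ↔ IsLUB s a := by
  rw [isLUB_iff_le_iff, isLUB_iff_le_iff]
  refine forall_congr' fun y => iff_congr Iff.rfl ⟨fun h x hx => ?_, fun h x hx => h hx.1⟩
  by_cases hb : x = ⊥
  · exact hb ▸ bot_le
  · exact h ⟨hx, hb⟩

theorem isLUB_bot_of_subset {E : Type*} [PartialOrder E] [OrderBot E] {s : Set E} (h : s ⊆ {⊥}) :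
    IsLUB s ⊥ :=
  ⟨fun _ hx => (h hx).le, fun _ _ => bot_le⟩

theorem directedOn_of_withBot_coe_image {s : Set (WithBot D)} {s' : Set D}
    (h : s \ {⊥} = (↑) '' s') (hd : DirectedOn (· ≤ ·) s) : DirectedOn (· ≤ ·) s' := by
  intro x hx y hy
  have mem : ∀ z : D, z ∈ s' → (z : WithBot D) ∈ s := fun z hz =>
    (h.symm.subset (Set.mem_image_of_mem _ hz)).1
  obtain ⟨z, hz, hxz, hyz⟩ := hd _ (mem x hx) _ (mem y hy)
  cases z with
  | bot => exact absurd hxz (WithBot.not_coe_le_bot x)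
  | coe z =>
    obtain ⟨z', hz', hzz⟩ := h.subset ⟨hz, WithBot.coe_ne_bot⟩
    exact ⟨z, WithBot.coe_inj.1 hzz ▸ hz', WithBot.coe_le_coe.1 hxz, WithBot.coe_le_coe.1 hyz⟩

/-- The lifting of a continuous function is continuous. -/
theorem scottContinuous_withBot_map {E : Type*} [PartialOrder E] {f : E → D}
    (hf : ScottContinuous f) : ScottContinuous (WithBot.map f) := by
  intro d hd hdd a ha
  obtain h | ⟨s, hs, h⟩ := withBot_subset_or_diff_eq_image d
  · rw [ha.unique (isLUB_bot_of_subset h)]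
    exact isLUB_bot_of_subset (by rintro _ ⟨x, hx, rfl⟩; rw [h hx]; rfl)
  · rw [← isLUB_diff_bot, h] at ha
    have hds := directedOn_of_withBot_coe_image h hdd
    cases a with
    | bot => exact absurd (ha.1 ⟨_, hs.some_mem, rfl⟩) (WithBot.not_coe_le_bot _)
    | coe a =>
      have hsa : IsLUB s a := isLUB_iff_le_iff.2 fun y => by
        have := isLUB_image_iff.1 ha y
        simpa [mem_upperBounds] using this
      have := isLUB_withBot_coe_image (hs.image f) (hf hs hds hsa)
      rw [WithBot.map_coe]
      rw [← isLUB_diff_bot]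
      convert this using 1
      ext x
      constructor
      · rintro ⟨⟨y, hy, rfl⟩, hyb⟩
        cases y with
        | bot => exact absurd rfl hyb
        | coe y =>
          obtain ⟨z, hz, hzy⟩ := h.subset ⟨hy, WithBot.coe_ne_bot⟩
          exact ⟨f y, ⟨y, WithBot.coe_inj.1 hzy ▸ hz, rfl⟩, rfl⟩
      · rintro ⟨_, ⟨y, hy, rfl⟩, rfl⟩
        exact ⟨⟨y, (h.symm.subset (Set.mem_image_of_mem _ hy)).1, rfl⟩, WithBot.coe_ne_bot⟩

theorem IsScottDomain.lift {X : PPos.{u}} (hX : IsScottDomain X) :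
    IsScottDomain (PPos.lift.obj X) := by
  change IsScottDomain (WithBot X)
  refine .of_base ?_ ?_ (insert ⊥ ((↑) '' {k : X | IsCompactElement k}))
    ((hX.countable_compact.image _).insert _) ?_ ?_
  · intro d _ hd
    obtain h | ⟨s, hs, h⟩ := withBot_subset_or_diff_eq_image d
    · exact ⟨⊥, isLUB_bot_of_subset h⟩
    · obtain ⟨a, ha⟩ := hX.dcpo s hs (directedOn_of_withBot_coe_image h hd)
      exact ⟨a, isLUB_diff_bot.1 (h ▸ isLUB_withBot_coe_image hs ha)⟩
  · rintro d ⟨b, hb⟩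
    obtain h | ⟨s, hs, h⟩ := withBot_subset_or_diff_eq_image d
    · exact ⟨⊥, isLUB_bot_of_subset h⟩
    · have hsb : ∀ x ∈ s, (x : WithBot X) ≤ b := fun x hx =>
        hb (h.symm.subset (Set.mem_image_of_mem _ hx)).1
      cases b with
      | bot => exact absurd (hsb _ hs.some_mem) (WithBot.not_coe_le_bot _)
      | coe b =>
        obtain ⟨a, ha⟩ := hX.boundedComplete s ⟨b, fun x hx => WithBot.coe_le_coe.1 (hsb x hx)⟩
        exact ⟨a, isLUB_diff_bot.1 (h ▸ isLUB_withBot_coe_image hs ha)⟩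
  · rintro _ (rfl | ⟨k, hk, rfl⟩) d a hd hdd ha hka
    · exact ⟨hd.some, hd.some_mem, bot_le⟩
    · obtain h | ⟨s, hs, h⟩ := withBot_subset_or_diff_eq_image d
      · rw [ha.unique (isLUB_bot_of_subset h)] at hka
        exact absurd hka (WithBot.not_coe_le_bot _)
      · obtain ⟨a', ha'⟩ := hX.dcpo s hs (directedOn_of_withBot_coe_image h hdd)
        have := isLUB_diff_bot.1 (h ▸ isLUB_withBot_coe_image hs ha')
        rw [ha.unique this] at hka
        obtain ⟨x, hx, hkx⟩ := hk s a' hs (directedOn_of_withBot_coe_image h hdd) ha'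
          (WithBot.coe_le_coe.1 hka)
        exact ⟨x, (h.symm.subset (Set.mem_image_of_mem _ hx)).1, WithBot.coe_le_coe.2 hkx⟩
  · intro x
    refine ⟨fun _ h => h.2, fun u hu => ?_⟩
    cases x with
    | bot => exact bot_le
    | coe x =>
      have h0 : IsCompactElement (⊥ : X) := fun s _ hs _ _ _ => ⟨hs.some, hs.some_mem, bot_le⟩
      refine (isLUB_withBot_coe_image (s := {k : X | IsCompactElement k ∧ k ≤ x})
        ⟨⊥, h0, bot_le⟩ (hX.isLUB_compact x)).2 ?_
      rintro _ ⟨k, ⟨hk, hkx⟩, rfl⟩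
      exact hu ⟨.inr ⟨k, hk, rfl⟩, WithBot.coe_le_coe.2 hkx⟩

end Order

/-! ### Products -/

section Products

open Classical in
theorem gc_update {L : Type*} (X : L → PPos.{u}) (l : L) :
    GaloisConnection (fun x : X l => (Function.update (fun _ => ⊥) l x : ∀ l, X l))
      (fun y => y l) := by
  intro x y
  rw [update_le_iff]
  simp

/-- Each factor embeds by putting `⊥` in all other coordinates, with evaluation as upper adjoint;
suprema are coordinatewise. -/
theorem IsScottDomain.pi {L : Type} [Countable L] {X : L → PPos.{u}}
    (hX : ∀ l, IsScottDomain (X l)) : IsScottDomain ((PPos.pi L).obj X) := by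
  classical
  change IsScottDomain (∀ l, X l)
  refine .of_family hX _ _ (gc_update X) scottContinuous_eval ?_ ?_ ?_
  · refine fun x => isLUB_range_iff.2 fun y => ?_
    simp only [(gc_update X _).le_iff_le]
    exact Iff.rfl
  · intro d hd hdd
    choose a ha using fun l => (hX l).dcpo (Function.eval l '' d) (hd.image _)
      (directedOn_image_of_monotone (Function.monotone_eval l) hdd)
    exact ⟨a, isLUB_pi.2 ha⟩
  · rintro s ⟨b, hb⟩
    choose a ha using fun l => (hX l).boundedComplete (Function.eval l '' s)
      ⟨b l, by rintro _ ⟨x, hx, rfl⟩; exact hb hx l⟩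
    exact ⟨a, isLUB_pi.2 ha⟩

theorem gc_inl (X Y : PPos.{u}) :
    GaloisConnection (fun x : X => (x, (⊥ : Y))) (fun z : X × Y => z.1) := by
  intro x z
  simp [Prod.le_def]

theorem gc_inr (X Y : PPos.{u}) :
    GaloisConnection (fun y : Y => ((⊥ : X), y)) (fun z : X × Y => z.2) := by
  intro x z
  simp [Prod.le_def]

theorem IsScottDomain.prod {X Y : PPos.{u}} (hX : IsScottDomain X) (hY : IsScottDomain Y) :
    IsScottDomain (PPos.prod.obj (X, Y)) := by
  change IsScottDomain (X × Y)
  -- The two factors are packaged as a family over `Bool`, with `true` for the left one.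
  let Z : Bool → PPos.{u} := fun b => cond b X Y
  refine .of_family (Z := Z)
    (Bool.rec hY hX) (Bool.rec (fun y : Y => ((⊥ : X), y)) (fun x : X => (x, (⊥ : Y))))
    (Bool.rec (fun z : X × Y => z.2) (fun z : X × Y => z.1))
    (Bool.rec (gc_inr X Y) (gc_inl X Y)) (Bool.rec ScottContinuous.snd ScottContinuous.fst)
    ?_ ?_ ?_
  · refine fun x => isLUB_range_iff.2 fun y => ?_
    rw [Bool.forall_bool, Prod.le_def]
    exact ((gc_inl X Y _ _).and (gc_inr X Y _ _)).symm.trans and_comm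
  · intro d hd hdd
    obtain ⟨a, ha⟩ := hX.dcpo (Prod.fst '' d) (hd.image _)
      (directedOn_image_of_monotone monotone_fst hdd)
    obtain ⟨b, hb⟩ := hY.dcpo (Prod.snd '' d) (hd.image _)
      (directedOn_image_of_monotone monotone_snd hdd)
    exact ⟨(a, b), isLUB_prod.2 ⟨ha, hb⟩⟩
  · rintro s ⟨c, hc⟩
    obtain ⟨a, ha⟩ := hX.boundedComplete (Prod.fst '' s)
      ⟨c.1, by rintro _ ⟨x, hx, rfl⟩; exact (hc hx).1⟩
    obtain ⟨b, hb⟩ := hY.boundedComplete (Prod.snd '' s)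
      ⟨c.2, by rintro _ ⟨x, hx, rfl⟩; exact (hc hx).2⟩
    exact ⟨(a, b), isLUB_prod.2 ⟨ha, hb⟩⟩

end Products

/-! ### Coalesced sums -/

section Sums

namespace PPos.CSum

variable {L : Type} {X : L → PPos.{u}}

open Classical in
/-- The projection of the coalesced sum onto a summand; the other summands are sent to `⊥`. -/
noncomputable def proj (l : L) : CSum X → X l :=
  WithBot.recBotCoe ⊥ fun a => if h : a.1 = l then h ▸ a.2.1 else ⊥

theorem proj_inj_self (l : L) (x : X l) : proj l (inj l x : CSum X) = x := by
  by_cases hx : x = ⊥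
  · rw [hx, inj_bot]; rfl
  · rw [inj, dif_neg hx]; exact dif_pos rfl

theorem proj_inj_of_ne {l l' : L} (h : l' ≠ l) (x : X l') : proj l (inj l' x : CSum X) = ⊥ := by
  by_cases hx : x = ⊥
  · rw [hx, inj_bot]; rfl
  · rw [inj, dif_neg hx]; exact dif_neg h

theorem eq_bot_or_eq_inj (z : CSum X) : z = ⊥ ∨ ∃ l, ∃ x : X l, x ≠ ⊥ ∧ z = inj l x := by
  induction z using WithBot.recBotCoe with
  | bot => exact .inl rfl
  | coe z =>
    refine .inr ⟨z.1, z.2.1, z.2.2, ?_⟩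
    rw [inj, dif_neg z.2.2]

theorem eq_bot_of_inj_le {l l' : L} (h : l ≠ l') {x : X l} {y : X l'}
    (hle : (inj l x : CSum X) ≤ inj l' y) : x = ⊥ := by
  by_contra hx
  rw [inj, dif_neg hx, inj] at hle
  split_ifs at hle with hy
  · exact WithBot.not_coe_le_bot _ hle
  · rw [WithBot.coe_le_coe] at hle
    cases hle
    exact h rfl

theorem gc (l : L) : GaloisConnection (inj l : X l → CSum X) (proj l) := by
  intro x z
  constructor
  · intro h
    obtain rfl | ⟨l', y, hy, rfl⟩ := eq_bot_or_eq_inj z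
    · by_cases hx : x = ⊥
      · exact hx ▸ bot_le
      · rw [inj, dif_neg hx] at h
        exact absurd h (WithBot.not_coe_le_bot _)
    · by_cases hl : l = l'
      · subst hl
        rw [proj_inj_self]
        by_cases hx : x = ⊥
        · exact hx ▸ bot_le
        · rw [inj, dif_neg hx, inj, dif_neg hy, WithBot.coe_le_coe] at h
          cases h with
          | fiber _ _ _ h => exact h
      · rw [eq_bot_of_inj_le hl h]
        exact bot_le
  · intro h
    obtain rfl | ⟨l', y, hy, rfl⟩ := eq_bot_or_eq_inj z
    · rw [le_bot_iff.1 h, inj_bot]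
    · by_cases hl : l' = l
      · subst hl
        rw [proj_inj_self] at h
        exact inj_mono _ h
      · rw [proj_inj_of_ne hl] at h
        rw [le_bot_iff.1 h, inj_bot]
        exact bot_le

/-- Distinct summands share only `⊥`, so whatever lies below an element of a summand belongs to that
summand. Bounded sets can thus be moved into a single summand and back. -/
theorem inj_proj_of_le_inj {l : L} {x : X l} {z : CSum X} (h : z ≤ inj l x) :
    inj l (proj l z) = z := by
  obtain rfl | ⟨l', y, hy, rfl⟩ := eq_bot_or_eq_inj z
  · exact inj_bot l
  · by_cases hl : l' = l
    · subst hl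
      rw [proj_inj_self]
    · exact absurd (eq_bot_of_inj_le hl h) hy

theorem image_inj_proj {d : Set (CSum X)} {l : L} {x : X l} (h : ∀ z ∈ d, z ≤ inj l x) :
    inj l '' (proj l '' d) = d := by
  rw [Set.image_image]
  exact (Set.image_congr fun z hz => inj_proj_of_le_inj (h z hz)).trans (Set.image_id' d)

/-- If the supremum lies in summand `l`, so does the whole set, and a bound on the projections
injects to a bound on the set. If it lies in another summand, its projection is `⊥`. -/
theorem scottContinuous_proj (l : L) : ScottContinuous (proj l : CSum X → X l) := by
  intro d hd hdd a ha
  refine ⟨fun _ ⟨z, hz, h⟩ => h ▸ (gc l).monotone_u (ha.1 hz), fun y hy => ?_⟩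
  obtain rfl | ⟨l', x, hx, rfl⟩ := eq_bot_or_eq_inj a
  · exact bot_le
  · by_cases hl : l' = l
    · subst hl
      rw [← proj_inj_self l' y]
      refine (gc l').monotone_u (ha.2 fun z hz => ?_)
      rw [← inj_proj_of_le_inj (ha.1 hz)]
      exact inj_mono _ (hy ⟨z, hz, rfl⟩)
    · rw [proj_inj_of_ne hl]
      exact bot_le

/-- One non-bottom element fixes the summand, since any other element has a common upper bound with
it. `Nonempty L` supplies an arbitrary summand when the set contains at most `⊥`. -/
theorem exists_inj_bound_of_directed [Nonempty L] {d : Set (CSum X)}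
    (hd : DirectedOn (· ≤ ·) d) : ∃ l, ∀ z ∈ d, inj l (proj l z) = z := by
  by_cases h : d ⊆ {⊥}
  · refine ⟨Classical.arbitrary L, fun z hz => ?_⟩
    rw [h hz]
    exact inj_bot _
  · obtain ⟨z, hz, hzb⟩ := Set.not_subset.1 h
    obtain rfl | ⟨l, x, hx, rfl⟩ := eq_bot_or_eq_inj z
    · exact absurd rfl hzb
    · refine ⟨l, fun w hw => ?_⟩
      obtain ⟨t, -, hwt, hzt⟩ := hd w hw _ hz
      obtain rfl | ⟨l', y, hy, rfl⟩ := eq_bot_or_eq_inj t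
      · exact absurd (le_bot_iff.1 hzt) hzb
      · by_cases hl : l = l'
        · subst hl
          exact inj_proj_of_le_inj hwt
        · exact absurd (eq_bot_of_inj_le hl hzt) hx

end PPos.CSum

-- The family is that of the injections with the projections as upper adjoints. Directed sets and
-- bounded sets alike sit in one summand (unless trivial), where the supremum is taken and then
-- pushed forward by the lower adjoint `CSum.inj`.
open PPos in
theorem IsScottDomain.csum {L : Type} [Countable L] {X : L → PPos.{u}}
    (hX : ∀ l, IsScottDomain (X l)) : IsScottDomain ((PPos.sum L).obj X) := by
  change IsScottDomain (CSum X)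
  refine .of_family hX _ _ CSum.gc CSum.scottContinuous_proj ?_ ?_ ?_
  · refine fun z => ⟨fun _ ⟨l, h⟩ => h ▸ (CSum.gc l).l_u_le z, fun u hu => ?_⟩
    obtain rfl | ⟨l, x, hx, rfl⟩ := CSum.eq_bot_or_eq_inj z
    · exact bot_le
    · have := hu ⟨l, rfl⟩
      dsimp only at this
      rwa [CSum.proj_inj_self] at this
  · intro d hd hdd
    obtain h | h := isEmpty_or_nonempty L
    · refine ⟨⊥, isLUB_bot_of_subset fun z _ => ?_⟩
      obtain rfl | ⟨l, -⟩ := CSum.eq_bot_or_eq_inj z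
      exacts [rfl, isEmptyElim l]
    · obtain ⟨l, hl⟩ := CSum.exists_inj_bound_of_directed hdd
      obtain ⟨a, ha⟩ := (hX l).dcpo (CSum.proj l '' d) (hd.image _)
        (directedOn_image_of_monotone (CSum.gc l).monotone_u hdd)
      refine ⟨CSum.inj l a, ?_⟩
      have := (CSum.gc l).isLUB_l_image ha
      rwa [Set.image_image, Set.image_congr hl, Set.image_id'] at this
  · rintro s ⟨b, hb⟩
    obtain rfl | ⟨l, x, hx, rfl⟩ := CSum.eq_bot_or_eq_inj b
    · exact ⟨⊥, isLUB_bot_of_subset fun z hz => le_bot_iff.1 (hb hz)⟩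
    · obtain ⟨a, ha⟩ := (hX l).boundedComplete (CSum.proj l '' s) ⟨x, by
        rintro _ ⟨z, hz, rfl⟩
        exact ((CSum.gc l).monotone_u (hb hz)).trans (CSum.proj_inj_self l x).le⟩
      refine ⟨CSum.inj l a, ?_⟩
      have := (CSum.gc l).isLUB_l_image ha
      rwa [CSum.image_inj_proj fun z hz => hb hz] at this

open PPos in
theorem scottContinuous_csum_map {L : Type} {X Y : L → PPos.{u}} {f : ∀ l, X l ⟶ Y l}
    (hf : ∀ l, ScottContinuous (f l).toFun) : ScottContinuous (CSum.map f) := by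
  intro d hd hdd a ha
  obtain rfl | ⟨l, x, hx, rfl⟩ := CSum.eq_bot_or_eq_inj a
  · refine isLUB_bot_of_subset ?_
    rintro _ ⟨z, hz, rfl⟩
    rw [le_bot_iff.1 (ha.1 hz)]
    rfl
  · have h1 := CSum.scottContinuous_proj l hd hdd ha
    rw [CSum.proj_inj_self] at h1
    have h2 := (CSum.gc l).isLUB_l_image (hf l (hd.image _)
      (directedOn_image_of_monotone (CSum.gc l).monotone_u hdd) h1)
    rw [CSum.map_inj]
    conv at h2 => arg 1; rw [Set.image_image, Set.image_image]
    convert h2 using 1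
    refine Set.image_congr fun z hz => ?_
    rw [← CSum.map_inj, CSum.inj_proj_of_le_inj (ha.1 hz)]

end Sums

/-! ### Function spaces -/

section FunctionSpaces

variable {X Y : PPos.{u}}

open Classical in
/-- The step function with value `y` above `k` and `⊥` elsewhere. -/
noncomputable def step (k : X) (y : Y) (x : X) : Y := if k ≤ x then y else ⊥

/-- Forming step functions at `k` is lower adjoint to evaluation at `k`; this is the adjunction that
makes function spaces algebraic. -/
theorem step_le_iff {k : X} {y : Y} {f : X → Y} (hf : Monotone f) :
    (∀ x, step k y x ≤ f x) ↔ y ≤ f k := by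
  constructor
  · intro h
    have := h k
    rwa [step, if_pos le_rfl] at this
  · intro h x
    rw [step]
    split_ifs with hx
    · exact h.trans (hf hx)
    · exact bot_le

theorem scottContinuous_step {k : X} (hk : IsCompactElement k) (y : Y) :
    ScottContinuous (step k y) := by
  intro d hd hdd a ha
  refine isLUB_image_iff.2 fun z => ?_
  by_cases hz : y ≤ z
  · have : ∀ x, step k y x ≤ z := fun x => by
      rw [step]; split_ifs
      exacts [hz, bot_le]
    simp [this]
  -- When `y ≰ z`, the goal negates to: `k ≤ a` exactly when `k` is below some member of `d`, which
  -- is compactness of `k`.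
  · have : ∀ x, step k y x ≤ z ↔ ¬ k ≤ x := fun x => by
      rw [step]; split_ifs with h
      · simp [h, hz]
      · simp [h]
    simp only [this]
    rw [not_iff_comm]
    push Not
    constructor
    · rintro ⟨x, hx, hkx⟩
      exact hkx.trans (ha.1 hx)
    · exact fun h => hk d a hd hdd ha h

/-- Every point is the directed supremum of the compact elements below it, and `f` preserves that
supremum. -/
theorem le_iff_forall_compact (hX : IsScottDomain X) {f g : X → Y} (hf : ScottContinuous f)
    (hg : Monotone g) : (∀ x, f x ≤ g x) ↔ ∀ k, IsCompactElement k → f k ≤ g k := by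
  refine ⟨fun h k _ => h k, fun h x => ?_⟩
  have h0 : IsCompactElement (⊥ : X) := fun s _ hs _ _ _ => ⟨hs.some, hs.some_mem, bot_le⟩
  refine (hf (d := {k : X | IsCompactElement k ∧ k ≤ x}) ⟨⊥, h0, bot_le⟩
    (hX.directed_compact x) (hX.isLUB_compact x)).2 ?_
  rintro _ ⟨k, ⟨hk, hkx⟩, rfl⟩
  exact (h k hk).trans (hg hkx)

/-- Least upper bounds of continuous functions are computed pointwise. -/
theorem isLUB_subtype_of_pointwise {P : (X → Y) → Prop} {S : Set {f : X → Y // P f}}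
    {g : {f : X → Y // P f}} (h : ∀ x, IsLUB ((fun f => f.1 x) '' S) (g.1 x)) : IsLUB S g :=
  ⟨fun f hf x => (h x).1 ⟨f, hf, rfl⟩, fun u hu x => (h x).2 <| by
    rintro _ ⟨f, hf, rfl⟩; exact hu hf x⟩

theorem scottContinuous_of_pointwise_subtype {P : (X → Y) → Prop}
    (hP : ∀ f, P f → ScottContinuous f) {S : Set {f : X → Y // P f}} {g : X → Y}
    (hg : ∀ x, IsLUB ((fun f => f.1 x) '' S) (g x)) : ScottContinuous g := by
  refine ScottContinuous.of_isLUB (S := Subtype.val '' S) ?_ ?_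
  · rintro _ ⟨f, -, rfl⟩
    exact hP f f.2
  · intro x
    rw [Set.image_image]
    exact hg x

/-- Spaces of continuous functions are closed under existing pointwise least upper bounds. -/
theorem exists_isLUB_subtype {P : (X → Y) → Prop} (hP : ∀ f, P f → ScottContinuous f)
    (hPl : ∀ (S : Set {f : X → Y // P f}) (g : X → Y), ScottContinuous g →
      (∀ x, IsLUB ((fun f => f.1 x) '' S) (g x)) → P g)
    {S : Set {f : X → Y // P f}} (h : ∀ x, ∃ a, IsLUB ((fun f => f.1 x) '' S) a) :
    ∃ g, IsLUB S g ∧ ∀ x, IsLUB ((fun f => f.1 x) '' S) (g.1 x) := by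
  choose g hg using h
  exact ⟨⟨g, hPl S g (scottContinuous_of_pointwise_subtype hP hg) hg⟩,
    isLUB_subtype_of_pointwise hg, hg⟩

theorem exists_isLUB_of_directed {P : (X → Y) → Prop} (hY : IsScottDomain Y)
    {S : Set {f : X → Y // P f}} (hS : S.Nonempty) (hd : DirectedOn (· ≤ ·) S) (x : X) :
    ∃ a, IsLUB ((fun f => f.1 x) '' S) a :=
  hY.dcpo _ (hS.image _)
    (directedOn_image_of_monotone (f := fun f : {f : X → Y // P f} => f.1 x)
      (fun f g (h : f.1 ≤ g.1) => h x) hd)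

theorem exists_isLUB_of_bddAbove {P : (X → Y) → Prop} (hY : IsScottDomain Y)
    {S : Set {f : X → Y // P f}} (hS : BddAbove S) (x : X) :
    ∃ a, IsLUB ((fun f => f.1 x) '' S) a := by
  obtain ⟨b, hb⟩ := hS
  exact hY.boundedComplete _ ⟨b.1 x, by rintro _ ⟨f, hf, rfl⟩; exact hb hf x⟩

/-- Common treatment of all continuous and of strict continuous functions. Copies of `Y`, one for
each `k ∈ K`, embed as step functions at `k`; `hle` says that the points of `K` suffice to compare
functions, and `hPl` keeps suprema pointwise, so that evaluation is continuous. -/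
theorem IsScottDomain.function_space {P : (X → Y) → Prop} [OrderBot {f : X → Y // P f}]
    (hX : IsScottDomain X)
    (hY : IsScottDomain Y) (hP : ∀ f, P f → ScottContinuous f)
    (hPl : ∀ (S : Set {f : X → Y // P f}) (g : X → Y), ScottContinuous g →
      (∀ x, IsLUB ((fun f => f.1 x) '' S) (g x)) → P g)
    (K : Set X) (hK : ∀ k ∈ K, IsCompactElement k) (hstep : ∀ k ∈ K, ∀ y, P (step k y))
    (hle : ∀ f g, P f → P g → (∀ k ∈ K, f k ≤ g k) → ∀ k, IsCompactElement k → f k ≤ g k) :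
    IsScottDomain {f : X → Y // P f} := by
  have hev : ∀ x, ScottContinuous fun f : {f : X → Y // P f} => f.1 x := by
    intro x d hd hdd a ha
    obtain ⟨g, hg, hgx⟩ := exists_isLUB_subtype hP hPl (exists_isLUB_of_directed hY hd hdd)
    rw [ha.unique hg]
    exact hgx x
  have : Countable K := (hX.countable_compact.mono hK).to_subtype
  have gc : ∀ k : K, GaloisConnection (fun y => ⟨step k.1 y, hstep k.1 k.2 y⟩)
      (fun f : {f : X → Y // P f} => f.1 k.1) :=
    fun k y f => step_le_iff (hP f f.2).monotone
  refine .of_family (ι := K) (Z := fun _ => Y) (fun _ => hY) _ _ gc (fun k => hev k.1) ?_ ?_ ?_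
  · refine fun f => isLUB_range_iff.2 fun g => ?_
    simp only [(gc _).le_iff_le]
    constructor
    · exact fun h k => h k.1
    · exact fun h => (le_iff_forall_compact hX (hP f f.2) (hP g g.2).monotone).2
        (hle f g f.2 g.2 fun k hk => h ⟨k, hk⟩)
  · intro d hd hdd
    obtain ⟨g, hg, -⟩ := exists_isLUB_subtype hP hPl (exists_isLUB_of_directed hY hd hdd)
    exact ⟨g, hg⟩
  · intro s hs
    obtain ⟨g, hg, -⟩ := exists_isLUB_subtype hP hPl (exists_isLUB_of_bddAbove hY hs)
    exact ⟨g, hg⟩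

theorem IsScottDomain.cfun (hX : IsScottDomain X) (hY : IsScottDomain Y) :
    IsScottDomain (PPos.cfun X Y) :=
  -- The bottom must be the one bundled in `PPos.cfun`, for the result to have the expected type.
  letI : OrderBot {f : X → Y // ScottContinuous f} := (PPos.cfun X Y).bot
  IsScottDomain.function_space (P := ScottContinuous) hX hY (fun _ h => h) (fun _ _ h _ => h)
    {k | IsCompactElement k} (fun _ h => h) (fun _ hk => scottContinuous_step hk)
    (fun _ _ _ _ h => h)

theorem strict_of_pointwise {P : (X → Y) → Prop} (hP : ∀ f, P f → f ⊥ = ⊥)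
    {S : Set {f : X → Y // P f}} {g : X → Y}
    (hg : ∀ x, IsLUB ((fun f => f.1 x) '' S) (g x)) : g ⊥ = ⊥ :=
  (hg ⊥).unique (isLUB_bot_of_subset (by rintro _ ⟨f, -, rfl⟩; exact hP f f.2))

/-- The point `⊥` is dropped from `K`: a step function at `⊥` is constant, hence not strict unless
trivial, and strict functions agree at `⊥` anyway. -/
theorem IsScottDomain.sfun (hX : IsScottDomain X) (hY : IsScottDomain Y) :
    IsScottDomain (PPos.sfun X Y) :=
  letI : OrderBot {f : X → Y // ScottContinuous f ∧ f ⊥ = ⊥} := (PPos.sfun X Y).bot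
  IsScottDomain.function_space (P := fun f => ScottContinuous f ∧ f ⊥ = ⊥) hX hY (fun _ h => h.1)
    (fun _ _ h hg => ⟨h, strict_of_pointwise (fun _ h => h.2) hg⟩)
    {k | IsCompactElement k ∧ k ≠ ⊥} (fun _ h => h.1)
    (fun _ hk y => ⟨scottContinuous_step hk.1 y, if_neg (mt le_bot_iff.1 hk.2)⟩)
    (fun f g hf hg h k hk => by
      by_cases hb : k = ⊥
      · rw [hb, hf.2, hg.2]
      · exact h k ⟨hk, hb⟩)

end FunctionSpaces

/-! ### Locally continuous functors on pointed posets -/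

/-- A category with distinguished objects (domains) and morphisms (continuous maps), an order on
hom-sets, and a notion of pointwise least upper bound of a set of morphisms. -/
class DomCat (C : Type v) [Category.{w} C] where
  /-- The object is a domain. -/
  IsDom : C → Prop
  /-- The morphism is continuous. -/
  IsCont {X Y : C} : (X ⟶ Y) → Prop
  /-- The pointwise order. -/
  Le {X Y : C} : (X ⟶ Y) → (X ⟶ Y) → Prop
  /-- Pointwise least upper bounds. -/
  IsSup {X Y : C} : Set (X ⟶ Y) → (X ⟶ Y) → Prop
  isCont_id (X : C) : IsCont (𝟙 X)
  le_refl {X Y : C} (f : X ⟶ Y) : Le f f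
  isSup_const {X Y : C} {S : Set (X ⟶ Y)} {g : X ⟶ Y} (hS : S.Nonempty) (h : ∀ f ∈ S, f = g) :
    IsSup S g

open DomCat

theorem isLUB_of_forall_eq {D : Type*} [Preorder D] {s : Set D} {a : D} (hs : s.Nonempty)
    (h : ∀ x ∈ s, x = a) : IsLUB s a :=
  ⟨fun x hx => (h x hx).le, fun _ hu => h _ hs.some_mem ▸ hu hs.some_mem⟩

instance : DomCat PPos.{u} where
  IsDom X := IsScottDomain X
  IsCont f := ScottContinuous f.toFun
  Le f g := ∀ x, f.toFun x ≤ g.toFun x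
  IsSup S g := ∀ x, IsLUB ((fun f => f.toFun x) '' S) (g.toFun x)
  isCont_id _ := ScottContinuous.id
  le_refl _ _ := le_rfl
  isSup_const hS h x := isLUB_of_forall_eq (hS.image _) <| by
    rintro _ ⟨f, hf, rfl⟩; rw [h f hf]

instance {I : Type} (C : Type v) [Category.{w} C] [DomCat C] : DomCat (I → C) where
  IsDom X := ∀ i, IsDom (X i)
  IsCont f := ∀ i, IsCont (f i)
  Le f g := ∀ i, Le (f i) (g i)
  IsSup S g := ∀ i, IsSup ((fun f => f i) '' S) (g i)
  isCont_id _ _ := isCont_id _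
  le_refl _ _ := le_refl _
  isSup_const hS h i := isSup_const (hS.image _) <| by
    rintro _ ⟨f, hf, rfl⟩; rw [h f hf]

instance (C : Type v₁) [Category.{w₁} C] [DomCat C] (D : Type v₂)
    [Category.{w₂} D] [DomCat D] : DomCat (C × D) where
  IsDom X := IsDom X.1 ∧ IsDom X.2
  IsCont f := IsCont f.1 ∧ IsCont f.2
  Le f g := Le f.1 g.1 ∧ Le f.2 g.2
  IsSup S g := IsSup ((fun f => f.1) '' S) g.1 ∧ IsSup ((fun f => f.2) '' S) g.2
  isCont_id _ := ⟨isCont_id _, isCont_id _⟩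
  le_refl _ := ⟨le_refl _, le_refl _⟩
  isSup_const hS h := ⟨isSup_const (hS.image _) <| by
    rintro _ ⟨f, hf, rfl⟩; rw [h f hf], isSup_const (hS.image _) <| by
    rintro _ ⟨f, hf, rfl⟩; rw [h f hf]⟩

/-- A functor that preserves domains and continuous maps and acts continuously on the hom-sets of
continuous maps between domains. -/
structure IsDomFunctor {C : Type*} [Category C] [DomCat C] {D : Type*} [Category D]
    [DomCat D] (P : C ⥤ D) : Prop where
  obj : ∀ {X : C}, IsDom X → IsDom (P.obj X)
  map : ∀ {X Y : C}, IsDom X → IsDom Y → ∀ {f : X ⟶ Y}, IsCont f → IsCont (P.map f)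
  le : ∀ {X Y : C}, IsDom X → IsDom Y → ∀ {f g : X ⟶ Y}, IsCont f → IsCont g → Le f g →
    Le (P.map f) (P.map g)
  sup : ∀ {X Y : C}, IsDom X → IsDom Y → ∀ {S : Set (X ⟶ Y)} {g : X ⟶ Y}, S.Nonempty →
    DirectedOn Le S → (∀ f ∈ S, IsCont f) → IsCont g → IsSup S g → IsSup (P.map '' S) (P.map g)

namespace IsDomFunctor

-- Closure of domain functors under composition and tupling

section Closure

variable {C : Type*} [Category C] [DomCat C] {D : Type*} [Category D] [DomCat D]
  {E : Type*} [Category E] [DomCat E]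

/-- Local monotonicity is part of the invariant for this purpose: the second functor of a composite
must receive a directed set. -/
theorem directedOn_image {P : C ⥤ D} (hP : IsDomFunctor P) {X Y : C} (hX : IsDom X) (hY : IsDom Y)
    {S : Set (X ⟶ Y)} (hd : DirectedOn Le S) (hc : ∀ f ∈ S, IsCont f) :
    DirectedOn Le (P.map '' S) := by
  rintro _ ⟨f, hf, rfl⟩ _ ⟨g, hg, rfl⟩
  obtain ⟨k, hk, hfk, hgk⟩ := hd f hf g hg
  exact ⟨_, ⟨k, hk, rfl⟩, hP.le hX hY (hc f hf) (hc k hk) hfk, hP.le hX hY (hc g hg) (hc k hk) hgk⟩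

theorem comp {P : C ⥤ D} {Q : D ⥤ E} (hP : IsDomFunctor P) (hQ : IsDomFunctor Q) :
    IsDomFunctor (P ⋙ Q) where
  obj h := hQ.obj (hP.obj h)
  map hX hY _ hf := hQ.map (hP.obj hX) (hP.obj hY) (hP.map hX hY hf)
  le hX hY _ _ hf hg h :=
    hQ.le (hP.obj hX) (hP.obj hY) (hP.map hX hY hf) (hP.map hX hY hg) (hP.le hX hY hf hg h)
  sup {X Y} hX hY S g hS hd hc hg h := by
    have := hQ.sup (hP.obj hX) (hP.obj hY) (hS.image _) (hP.directedOn_image hX hY hd hc)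
      (by rintro _ ⟨f, hf, rfl⟩; exact hP.map hX hY (hc f hf)) (hP.map hX hY hg)
      (hP.sup hX hY hS hd hc hg h)
    rwa [Set.image_image] at this

theorem const {d : D} (hd : IsDom d) : IsDomFunctor ((Functor.const C).obj d) where
  obj _ := hd
  map _ _ _ _ := isCont_id _
  le _ _ _ _ _ _ _ := le_refl _
  sup _ _ _ _ hS _ _ _ _ := isSup_const (hS.image _) (by rintro _ ⟨f, -, rfl⟩; rfl)

theorem id : IsDomFunctor (𝟭 C) where
  obj h := h
  map _ _ _ hf := hf
  le _ _ _ _ _ _ h := h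
  sup _ _ S g _ _ _ _ h := by
    change IsSup ((fun f => f) '' S) g
    rwa [Set.image_id']

theorem eval {I : Type} (i : I) : IsDomFunctor (Pi.eval (fun _ : I => C) i) where
  obj h := h i
  map _ _ _ hf := hf i
  le _ _ _ _ _ _ h := h i
  sup _ _ _ _ _ _ _ _ h := h i

theorem pi' {I : Type} {P : I → (C ⥤ D)} (hP : ∀ i, IsDomFunctor (P i)) :
    IsDomFunctor (Functor.pi' P) where
  obj h i := (hP i).obj h
  map hX hY _ hf i := (hP i).map hX hY hf
  le hX hY _ _ hf hg h i := (hP i).le hX hY hf hg h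
  sup hX hY S g hS hd hc hg h i := by
    rw [Set.image_image]
    exact (hP i).sup hX hY hS hd hc hg h

theorem prod' {P : C ⥤ D} {Q : C ⥤ E} (hP : IsDomFunctor P) (hQ : IsDomFunctor Q) :
    IsDomFunctor (P.prod' Q) where
  obj h := ⟨hP.obj h, hQ.obj h⟩
  map hX hY _ hf := ⟨hP.map hX hY hf, hQ.map hX hY hf⟩
  le hX hY _ _ hf hg h := ⟨hP.le hX hY hf hg h, hQ.le hX hY hf hg h⟩
  sup hX hY S g hS hd hc hg h := by
    refine ⟨?_, ?_⟩ <;> rw [Set.image_image]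
    · exact hP.sup hX hY hS hd hc hg h
    · exact hQ.sup hX hY hS hd hc hg h

theorem sectR {c : C} (hc : IsDom c) : IsDomFunctor (Prod.sectR c D) :=
  (const hc).prod' id

end Closure

-- Environment extension and the basic domain constructors as domain functors

theorem extend {C : Type*} [Category C] [DomCat C] (n : ℕ) :
    IsDomFunctor (SessionTypes.extend C n) where
  obj h := Fin.cases h.2 h.1
  map _ _ _ hf := Fin.cases hf.2 hf.1
  le _ _ _ _ _ _ h := Fin.cases h.2 h.1
  sup _ _ S g _ _ _ _ h := by
    refine Fin.cases ?_ fun i => ?_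
    · rw [Set.image_image]
      exact h.2
    · have := h.1 i
      rw [Set.image_image] at this ⊢
      exact this

theorem lift : IsDomFunctor PPos.lift.{u} where
  obj h := h.lift
  map _ _ _ hf := scottContinuous_withBot_map hf
  le _ _ f g _ _ h x := by
    induction x using WithBot.recBotCoe with
    | bot => exact le_rfl
    | coe x => exact WithBot.coe_le_coe.2 (h x)
  sup _ _ S g hS _ _ _ h x := by
    rw [Set.image_image]
    induction x using WithBot.recBotCoe with
    | bot =>
      refine isLUB_bot_of_subset ?_
      rintro _ ⟨f, -, rfl⟩
      rfl
    | coe x =>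
      have := isLUB_withBot_coe_image (hS.image _) (h x)
      rwa [Set.image_image] at this

theorem pi (L : Type) [Countable L] : IsDomFunctor (PPos.pi.{u} L) where
  obj h := IsScottDomain.pi h
  map _ _ _ hf := scottContinuous_pi fun l => (scottContinuous_eval l).comp (hf l)
  le _ _ _ _ _ _ h x l := h l (x l)
  sup {X Y} _ _ S g _ _ _ _ h x := by
    rw [Set.image_image]
    change IsLUB ((fun (f : X ⟶ Y) l => (f l).toFun (x l)) '' S) fun l => (g l).toFun (x l)
    refine isLUB_pi.2 fun l => ?_
    have := h l (x l)
    rw [Set.image_image] at this ⊢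
    exact this

theorem prod : IsDomFunctor PPos.prod.{u} where
  obj h := IsScottDomain.prod h.1 h.2
  map _ _ _ hf := (ScottContinuous.fst.comp hf.1).prodMk (ScottContinuous.snd.comp hf.2)
  le _ _ _ _ _ _ h x := ⟨h.1 x.1, h.2 x.2⟩
  sup {X Y} _ _ S g _ _ _ _ h x := by
    have h1 := h.1 x.1
    have h2 := h.2 x.2
    rw [Set.image_image] at h1 h2 ⊢
    change IsLUB ((fun f : X ⟶ Y => (f.1.toFun x.1, f.2.toFun x.2)) '' S)
      (g.1.toFun x.1, g.2.toFun x.2)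
    refine isLUB_prod.2 ⟨?_, ?_⟩ <;> rw [Set.image_image]
    exacts [h1, h2]

open PPos in
theorem sum (L : Type) [Countable L] : IsDomFunctor (PPos.sum.{u} L) where
  obj h := IsScottDomain.csum h
  map _ _ _ hf := scottContinuous_csum_map hf
  le _ _ f g _ _ h x := by
    change CSum.map f x ≤ CSum.map g x
    obtain rfl | ⟨l, x, hx, rfl⟩ := CSum.eq_bot_or_eq_inj x
    · exact le_rfl
    · rw [CSum.map_inj, CSum.map_inj]
      exact CSum.inj_mono l (h l x)
  sup _ _ S g hS _ _ _ h x := by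
    rw [Set.image_image]
    change IsLUB ((fun f => CSum.map f x) '' S) (CSum.map g x)
    obtain rfl | ⟨l, x, hx, rfl⟩ := CSum.eq_bot_or_eq_inj x
    · refine isLUB_bot_of_subset ?_
      rintro _ ⟨f, -, rfl⟩
      rfl
    · simp only [CSum.map_inj]
      have := (CSum.gc l).isLUB_l_image (h l x)
      rwa [Set.image_image, Set.image_image] at this

end IsDomFunctor

/-- Directed sets of continuous maps between domains have pointwise least upper bounds. -/
theorem exists_isSup {X Y : PPos.{u}} (hY : IsDom Y) {S : Set (X ⟶ Y)} (hS : S.Nonempty)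
    (hd : DirectedOn Le S) (hc : ∀ f ∈ S, IsCont f) : ∃ g : X ⟶ Y, IsCont g ∧ IsSup S g := by
  have hx : ∀ x, ∃ a, IsLUB ((fun f : X ⟶ Y => f.toFun x) '' S) a := by
    intro x
    refine hY.dcpo _ (hS.image _) ?_
    rintro _ ⟨f, hf, rfl⟩ _ ⟨g, hg, rfl⟩
    obtain ⟨k, hk, hfk, hgk⟩ := hd f hf g hg
    exact ⟨_, ⟨k, hk, rfl⟩, hfk x, hgk x⟩
  choose g hg using hx
  have hgc : ScottContinuous g := by
    refine ScottContinuous.of_isLUB (S := PPos.Hom.toFun '' S) ?_ ?_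
    · rintro _ ⟨f, hf, rfl⟩
      exact hc f hf
    · intro x
      rw [Set.image_image]
      exact hg x
  refine ⟨⟨g, hgc.monotone, ?_⟩, hgc, hg⟩
  exact (hg ⊥).unique (isLUB_bot_of_subset (by rintro _ ⟨f, -, rfl⟩; exact f.strict))

namespace PPos

theorem comp_map_toFun (H : PPos.{u} ⥤ PPos.{u}) {X Y Z : PPos.{u}} (f : X ⟶ Y) (g : Y ⟶ Z)
    (x : H.obj X) : (H.map g).toFun ((H.map f).toFun x) = (H.map (f ≫ g)).toFun x := by
  rw [H.map_comp]; rfl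

-- The bilimit as a set of threads: embeddings, projections and structure map

section Fix

variable {C : Type v} [Category.{w} C] (F : C × PPos.{u} ⥤ PPos.{u})

/-- The functor `F (c, -)`. -/
abbrev slice (c : C) : PPos.{u} ⥤ PPos.{u} := Prod.sectR c PPos.{u} ⋙ F

/-- The embeddings `X_n ⟶ X_{n+1}`. -/
def fixEmb (c : C) : ∀ n, fixObj F c n ⟶ fixObj F c (n + 1)
  | 0 => botHom _ _
  | n + 1 => (slice F c).map (fixEmb c n)

/-- Strictness makes the one-point poset initial; this starts the inductions along the chain. -/
theorem one_hom_ext {X : PPos.{u}} {f g : one ⟶ X} : f = g :=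
  hom_ext fun x => by
    have hx : x = ⊥ := rfl
    rw [hx, f.strict, g.strict]

theorem fixEmb_proj (c : C) : ∀ n, fixEmb F c n ≫ fixProj F c n = 𝟙 (fixObj F c n)
  | 0 => rfl
  | n + 1 => ((slice F c).map_comp _ _).symm.trans
      ((congrArg (slice F c).map (fixEmb_proj c n)).trans ((slice F c).map_id _))

/-- The projections of the bilimit. -/
def daggerProj (c : C) (n : ℕ) : (dagger F).obj c ⟶ fixObj F c n where
  toFun x := x.1 n
  mono _ _ h := h n
  strict := rfl

theorem daggerProj_proj (c : C) (n : ℕ) :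
    daggerProj F c (n + 1) ≫ fixProj F c n = daggerProj F c n :=
  hom_ext fun x => x.2 n

/-- The structure map `F (c, F† c) ⟶ F† c`. -/
def fold (c : C) : (slice F c).obj ((dagger F).obj c) ⟶ (dagger F).obj c where
  toFun y := ⟨fun n => match n with
    | 0 => PUnit.unit
    | n + 1 => ((slice F c).map (daggerProj F c n)).toFun y, fun n => match n with
    | 0 => rfl
    | n + 1 => by
      change ((slice F c).map (fixProj F c n)).toFun
        (((slice F c).map (daggerProj F c (n + 1))).toFun y) = _
      rw [comp_map_toFun, daggerProj_proj]⟩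
  mono _ _ h n := match n with
    | 0 => le_rfl
    | n + 1 => ((slice F c).map (daggerProj F c n)).mono h
  strict := Subtype.ext <| funext fun n => match n with
    | 0 => rfl
    | n + 1 => ((slice F c).map (daggerProj F c n)).strict

theorem dagger_map_daggerProj {c d : C} (f : c ⟶ d) (n : ℕ) :
    (dagger F).map f ≫ daggerProj F d n = daggerProj F c n ≫ fixMap F f n := rfl

/-- The structure map is natural. -/
theorem fold_naturality {c d : C} (f : c ⟶ d) :
    F.map (Prod.mkHom f ((dagger F).map f)) ≫ fold F d = fold F c ≫ (dagger F).map f := by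
  refine hom_ext fun y => Subtype.ext (funext fun n => ?_)
  cases n with
  | zero => rfl
  | succ n =>
    have : F.map (Prod.mkHom f ((dagger F).map f)) ≫ F.map (Prod.mkHom (𝟙 d) (daggerProj F d n)) =
        F.map (Prod.mkHom (𝟙 c) (daggerProj F c n)) ≫ F.map (Prod.mkHom f (fixMap F f n)) := by
      rw [← F.map_comp, ← F.map_comp]
      refine congrArg F.map (Prod.ext ?_ (dagger_map_daggerProj F f n))
      exact (Category.comp_id f).trans (Category.id_comp f).symm
    exact congrArg (fun k => k.toFun y) this

/-- The embeddings of the bilimit. -/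
def daggerEmb (c : C) : ∀ n, fixObj F c n ⟶ (dagger F).obj c
  | 0 => botHom _ _
  | n + 1 => (slice F c).map (daggerEmb c n) ≫ fold F c

theorem fixEmb_daggerEmb (c : C) :
    ∀ n, fixEmb F c n ≫ daggerEmb F c (n + 1) = daggerEmb F c n
  | 0 => one_hom_ext
  | n + 1 => by
    change (slice F c).map (fixEmb F c n) ≫ (slice F c).map (daggerEmb F c (n + 1)) ≫ fold F c = _
    rw [← Category.assoc, ← Functor.map_comp, fixEmb_daggerEmb c n]
    rfl

theorem daggerEmb_proj (c : C) :
    ∀ n, daggerEmb F c n ≫ daggerProj F c n = 𝟙 (fixObj F c n)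
  | 0 => one_hom_ext
  | n + 1 => by
    change (slice F c).map (daggerEmb F c n) ≫ (slice F c).map (daggerProj F c n) = _
    rw [← Functor.map_comp, daggerEmb_proj c n, CategoryTheory.Functor.map_id]
    rfl

/-- The idempotents of the bilimit. -/
def daggerIdem (c : C) (n : ℕ) : (dagger F).obj c ⟶ (dagger F).obj c :=
  daggerProj F c n ≫ daggerEmb F c n

variable {F} in
theorem comp_daggerProj_of_le {c : C} {g : (dagger F).obj c ⟶ (dagger F).obj c} {m n : ℕ}
    (hmn : m ≤ n) (h : g ≫ daggerProj F c n = daggerProj F c n) :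
    g ≫ daggerProj F c m = daggerProj F c m := by
  induction n, hmn using Nat.le_induction with
  | base => exact h
  | succ n _ ih =>
    refine ih ?_
    rw [← daggerProj_proj, ← Category.assoc, h]

theorem daggerIdem_proj (c : C) {m n : ℕ} (hmn : m ≤ n) :
    daggerIdem F c n ≫ daggerProj F c m = daggerProj F c m := by
  refine comp_daggerProj_of_le hmn ?_
  rw [daggerIdem, Category.assoc, daggerEmb_proj]
  rfl

variable {F} in
/-- An increasing sequence of endomaps of the bilimit such that the `n`-th one fixes the `n`-th
component has the identity as its least upper bound. -/
theorem isLUB_of_comp_daggerProj {c : C} {g : ℕ → ((dagger F).obj c ⟶ (dagger F).obj c)}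
    (x : (dagger F).obj c) (hg : Monotone fun n => (g n).toFun x)
    (h : ∀ n, g n ≫ daggerProj F c n = daggerProj F c n) :
    IsLUB (Set.range fun n => (g n).toFun x) x := by
  have key : ∀ {m n}, m ≤ n → ((g n).toFun x).1 m = x.1 m := fun hmn =>
    congrArg (fun k => k.toFun x) (comp_daggerProj_of_le hmn (h _))
  refine ⟨?_, fun y hy m => ?_⟩
  · rintro _ ⟨n, rfl⟩ m
    -- At component `m`, enlarging the index to `max n m` reaches a map that fixes this component.
    exact (hg (le_max_left n m) m).trans (key (le_max_right n m)).le
  · exact (key le_rfl).symm.le.trans (hy ⟨m, rfl⟩ m)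

end Fix

-- The bilimit is a Scott domain, a fixed point, and a domain functor of its parameter

section Domains

variable {C : Type v} [Category.{w} C] [DomCat C] {F : C × PPos.{u} ⥤ PPos.{u}}
  (hF : IsDomFunctor F) {c : C} (hc : IsDom c)

theorem isDom_one : IsDom one.{u} := SDom.one.isScott

theorem isCont_botHom (X Y : PPos.{u}) : IsCont (botHom X Y) := ScottContinuous.const ⊥

include hF hc

theorem isDomFunctor_slice : IsDomFunctor (slice F c) := (IsDomFunctor.sectR hc).comp hF

theorem isDom_fixObj : ∀ n, IsDom (fixObj F c n)
  | 0 => isDom_one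
  | n + 1 => (isDomFunctor_slice hF hc).obj (isDom_fixObj n)

theorem isCont_fixProj : ∀ n, IsCont (fixProj F c n)
  | 0 => isCont_botHom _ _
  | n + 1 => (isDomFunctor_slice hF hc).map (isDom_fixObj hF hc _) (isDom_fixObj hF hc _)
      (isCont_fixProj n)

theorem isCont_fixEmb : ∀ n, IsCont (fixEmb F c n)
  | 0 => isCont_botHom _ _
  | n + 1 => (isDomFunctor_slice hF hc).map (isDom_fixObj hF hc _) (isDom_fixObj hF hc _)
      (isCont_fixEmb n)

/-- Trivial at the bottom stage, and carried upward by local monotonicity; with `fixEmb_proj` it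
makes each stage an embedding-projection pair. -/
theorem fixProj_emb_le : ∀ n, Le (fixProj F c n ≫ fixEmb F c n) (𝟙 _)
  | 0 => fun _ => bot_le
  | n + 1 => by
    have := (isDomFunctor_slice hF hc).le (isDom_fixObj hF hc _) (isDom_fixObj hF hc _)
      ((isCont_fixProj hF hc n).comp (isCont_fixEmb hF hc n)) (isCont_id _) (fixProj_emb_le n)
    rw [Functor.map_comp, CategoryTheory.Functor.map_id] at this
    exact this

theorem fixProj_gc (n : ℕ) : GaloisConnection (fixEmb F c n).toFun (fixProj F c n).toFun := by
  intro x y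
  constructor
  · intro h
    exact (congrArg (fun k => k.toFun x) (fixEmb_proj F c n)).symm.le.trans
      ((fixProj F c n).mono h)
  · exact fun h => ((fixEmb F c n).mono h).trans (fixProj_emb_le hF hc n y)

theorem daggerIdem_mono (x : (dagger F).obj c) : Monotone fun n => (daggerIdem F c n).toFun x := by
  refine monotone_nat_of_le_succ fun n => ?_
  have : daggerIdem F c n = daggerProj F c (n + 1) ≫ (fixProj F c n ≫ fixEmb F c n) ≫
      daggerEmb F c (n + 1) := by
    rw [daggerIdem, ← daggerProj_proj, ← fixEmb_daggerEmb]
    simp only [Category.assoc]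
  rw [this]
  exact (daggerEmb F c (n + 1)).mono (fixProj_emb_le hF hc n _)

theorem isLUB_daggerIdem (x : (dagger F).obj c) :
    IsLUB (Set.range fun n => (daggerIdem F c n).toFun x) x :=
  isLUB_of_comp_daggerProj x (daggerIdem_mono hF hc x) fun _ => daggerIdem_proj F c le_rfl

theorem daggerProj_gc (n : ℕ) :
    GaloisConnection (daggerEmb F c n).toFun (daggerProj F c n).toFun := by
  intro x y
  constructor
  · intro h
    exact (congrArg (fun k => k.toFun x) (daggerEmb_proj F c n)).symm.le.trans
      ((daggerProj F c n).mono h)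
  · exact fun h => ((daggerEmb F c n).mono h).trans ((isLUB_daggerIdem hF hc y).1 ⟨n, rfl⟩)

omit [DomCat C] hF hc in
theorem dagger_isLUB {d : Set ((dagger F).obj c)} {a : (dagger F).obj c}
    (h : ∀ n, IsLUB ((daggerProj F c n).toFun '' d) (a.1 n)) : IsLUB d a :=
  ⟨fun x hx n => (h n).1 ⟨x, hx, rfl⟩, fun y hy n => (h n).2 <| by
    rintro _ ⟨x, hx, rfl⟩; exact hy hx n⟩

/-- Directed least upper bounds in the bilimit are computed componentwise. -/
theorem dagger_exists_isLUB {d : Set ((dagger F).obj c)} (hd : d.Nonempty)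
    (hdd : DirectedOn (· ≤ ·) d) :
    ∃ a : (dagger F).obj c, ∀ n, IsLUB ((daggerProj F c n).toFun '' d) (a.1 n) := by
  have hdir := fun n => directedOn_image_of_monotone (daggerProj F c n).mono hdd
  choose a ha using fun n => (isDom_fixObj hF hc n).dcpo _ (hd.image _) (hdir n)
  refine ⟨⟨a, fun n => ?_⟩, ha⟩
  have := isCont_fixProj hF hc n (hd.image _) (hdir (n + 1)) (ha (n + 1))
  rw [Set.image_image] at this
  refine this.unique ?_
  convert ha n using 1
  exact Set.image_congr fun x _ => x.2 n

theorem isCont_daggerProj (n : ℕ) : IsCont (daggerProj F c n) := by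
  intro d hd hdd a ha
  obtain ⟨b, hb⟩ := dagger_exists_isLUB hF hc hd hdd
  rw [ha.unique (dagger_isLUB hb)]
  exact hb n

-- Suprema that exist in every component are suprema of threads, so continuity can be tested
-- componentwise.
omit [DomCat C] hF hc in
theorem isCont_of_comp_daggerProj {X : PPos.{u}} {f : X ⟶ (dagger F).obj c}
    (h : ∀ n, IsCont (f ≫ daggerProj F c n)) : IsCont f := by
  intro d hd hdd a ha
  refine dagger_isLUB fun n => ?_
  rw [Set.image_image]
  exact h n hd hdd ha

/-- Projections need not preserve bounded joins, but as upper adjoints they preserve meets. The join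
is therefore built as the meet of all upper bounds, which is a thread when taken componentwise. -/
theorem dagger_boundedComplete (s : Set ((dagger F).obj c)) (hs : BddAbove s) :
    ∃ a, IsLUB s a := by
  have hglb : ∀ n, ∃ a, IsGLB ((daggerProj F c n).toFun '' upperBounds s) a := by
    intro n
    -- The meet is obtained as the join of the lower bounds, which any one upper bound of `s` bounds
    -- from above.
    obtain ⟨a, ha⟩ := (isDom_fixObj hF hc n).boundedComplete
      (lowerBounds ((daggerProj F c n).toFun '' upperBounds s))
      ⟨_, fun x hx => hx ⟨hs.some, hs.some_mem, rfl⟩⟩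
    exact ⟨a, isLUB_lowerBounds.1 ha⟩
  choose a ha using hglb
  have hthread : ∀ n, (fixProj F c n).toFun (a (n + 1)) = a n := by
    intro n
    have := (fixProj_gc hF hc n).isGLB_u_image (ha (n + 1))
    rw [Set.image_image] at this
    refine this.unique ?_
    convert ha n using 1
    exact Set.image_congr fun x _ => x.2 n
  refine ⟨⟨a, hthread⟩, fun x hx n => (ha n).2 ?_, fun y hy n => (ha n).1 ⟨y, hy, rfl⟩⟩
  rintro _ ⟨y, hy, rfl⟩
  exact hy hx n

theorem isDom_dagger : IsDom ((dagger F).obj c) :=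
  IsScottDomain.of_family (isDom_fixObj hF hc) _ _ (daggerProj_gc hF hc) (isCont_daggerProj hF hc)
    (isLUB_daggerIdem hF hc)
    (fun _ hd hdd => (dagger_exists_isLUB hF hc hd hdd).imp fun _ h => dagger_isLUB h)
    (dagger_boundedComplete hF hc)

theorem isCont_daggerEmb (n : ℕ) : IsCont (daggerEmb F c n) :=
  (daggerProj_gc hF hc n).scottContinuous

theorem isCont_fold : IsCont (fold F c) := by
  refine isCont_of_comp_daggerProj fun n => ?_
  cases n with
  | zero => exact ScottContinuous.const _
  | succ n =>
    exact (isDomFunctor_slice hF hc).map (isDom_dagger hF hc) (isDom_fixObj hF hc n)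
      (isCont_daggerProj hF hc n)

/-- With `H = F (c, -)`, the inverse is the supremum of the increasing maps `s n = H e_n ∘ r_{n+1}`.
-/
theorem exists_fold_inv : ∃ g : (dagger F).obj c ⟶ (slice F c).obj ((dagger F).obj c),
    fold F c ≫ g = 𝟙 _ ∧ g ≫ fold F c = 𝟙 _ := by
  have hK := isDomFunctor_slice hF hc
  have hD := isDom_dagger hF hc
  have hX := isDom_fixObj hF hc
  let s : ℕ → ((dagger F).obj c ⟶ (slice F c).obj ((dagger F).obj c)) := fun n =>
    daggerProj F c (n + 1) ≫ (slice F c).map (daggerEmb F c n)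
  have hs : ∀ x, Monotone fun n => (s n).toFun x := by
    refine fun x => monotone_nat_of_le_succ fun n => ?_
    have h1 : (s n).toFun x = ((slice F c).map (daggerEmb F c (n + 1))).toFun
        (((slice F c).map (fixEmb F c n)).toFun (x.1 (n + 1))) := by
      refine Eq.trans ?_ (comp_map_toFun (slice F c) (fixEmb F c n) (daggerEmb F c (n + 1))
        (x.1 (n + 1))).symm
      rw [fixEmb_daggerEmb]
      rfl
    -- Now `s n` at `x` is `H e_{n+1}` of an embedding-projection round trip of `x_{n+2}`, hence
    -- below `s (n + 1)` at `x`.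
    rw [h1, ← x.2 (n + 1)]
    exact ((slice F c).map (daggerEmb F c (n + 1))).mono (fixProj_emb_le hF hc (n + 1) _)
  have hsc : ∀ n, IsCont (s n) := fun n => (isCont_daggerProj hF hc (n + 1)).comp
    (hK.map (hX n) hD (isCont_daggerEmb hF hc n))
  obtain ⟨g, -, hg⟩ := exists_isSup (S := Set.range s) (hK.obj hD) (Set.range_nonempty s)
    (by
      rintro _ ⟨m, rfl⟩ _ ⟨n, rfl⟩
      exact ⟨_, ⟨max m n, rfl⟩, fun x => hs x (le_max_left m n), fun x => hs x (le_max_right m n)⟩)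
    (by rintro _ ⟨n, rfl⟩; exact hsc n)
  have hg' : ∀ x, IsLUB (Set.range fun n => (s n).toFun x) (g.toFun x) := fun x => by
    have := hg x
    rwa [← Set.range_comp] at this
  refine ⟨g, hom_ext fun y => ?_, hom_ext fun x => ?_⟩
  · have h1 := hg' ((fold F c).toFun y)
    -- After `fold`, the map `s n` becomes `H (e_n ∘ r_n)`, and local continuity takes the supremum
    -- of the idempotents inside `H`.
    have h2 := hK.sup hD hD (S := Set.range (daggerIdem F c)) (g := 𝟙 _)
      (Set.range_nonempty _)
      (by
        rintro _ ⟨m, rfl⟩ _ ⟨n, rfl⟩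
        exact ⟨_, ⟨max m n, rfl⟩, fun x => daggerIdem_mono hF hc x (le_max_left m n),
          fun x => daggerIdem_mono hF hc x (le_max_right m n)⟩)
      (by
        rintro _ ⟨n, rfl⟩
        exact (isCont_daggerProj hF hc n).comp (isCont_daggerEmb hF hc n))
      (isCont_id _)
      (fun x => by
        rw [← Set.range_comp]
        exact isLUB_daggerIdem hF hc x) y
    rw [← Set.range_comp, ← Set.range_comp, CategoryTheory.Functor.map_id] at h2
    refine h1.unique ?_
    convert h2 using 1
    refine congrArg Set.range (funext fun n => ?_)
    change ((slice F c).map (daggerEmb F c n)).toFun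
      (((slice F c).map (daggerProj F c n)).toFun y) = _
    rw [comp_map_toFun]
    rfl
  · have h1 := isCont_fold hF hc (Set.range_nonempty _)
      ((hs x).directed_le.directedOn_range) (hg' x)
    rw [← Set.range_comp] at h1
    refine h1.unique ?_
    -- By definition of `e_{n+1}`, composing `s n` with `fold` gives the idempotent of index `n +
    -- 1`; the shift by one does not affect the supremum.
    have h2 : (fun n => (daggerIdem F c (n + 1)).toFun x) =
      (fold F c).toFun ∘ fun n => (s n).toFun x := rfl
    rw [← h2]
    refine isLUB_of_comp_daggerProj (g := fun n => daggerIdem F c (n + 1)) x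
      (fun m n h => daggerIdem_mono hF hc x (Nat.succ_le_succ h))
      fun n => daggerIdem_proj F c n.le_succ

/-- The structure map of the bilimit is an isomorphism. -/
noncomputable def foldIso : (slice F c).obj ((dagger F).obj c) ≅ (dagger F).obj c where
  hom := fold F c
  inv := (exists_fold_inv hF hc).choose
  hom_inv_id := (exists_fold_inv hF hc).choose_spec.1
  inv_hom_id := (exists_fold_inv hF hc).choose_spec.2

omit hc

theorem isCont_fixMap {c d : C} (hc : IsDom c) (hd : IsDom d) {f : c ⟶ d} (hf : IsCont f) :
    ∀ n, IsCont (fixMap F f n)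
  | 0 => isCont_botHom _ _
  | n + 1 => hF.map (X := (c, fixObj F c n)) (Y := (d, fixObj F d n)) ⟨hc, isDom_fixObj hF hc n⟩
      ⟨hd, isDom_fixObj hF hd n⟩ ⟨hf, isCont_fixMap hc hd hf n⟩

theorem fixMap_le {c d : C} (hc : IsDom c) (hd : IsDom d) {f g : c ⟶ d} (hf : IsCont f)
    (hg : IsCont g) (h : Le f g) : ∀ n, Le (fixMap F f n) (fixMap F g n)
  | 0 => le_refl _
  | n + 1 => hF.le (X := (c, fixObj F c n)) (Y := (d, fixObj F d n)) ⟨hc, isDom_fixObj hF hc n⟩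
      ⟨hd, isDom_fixObj hF hd n⟩ ⟨hf, isCont_fixMap hF hc hd hf n⟩
      ⟨hg, isCont_fixMap hF hc hd hg n⟩ ⟨h, fixMap_le hc hd hf hg h n⟩

/-- Induction along the chain: `F` is applied to the set of pairs `(f, fixMap F f n)`, which is
directed because `fixMap` is monotone in `f`. -/
theorem isSup_fixMap {c d : C} (hc : IsDom c) (hd : IsDom d) {S : Set (c ⟶ d)} {g : c ⟶ d}
    (hS : S.Nonempty) (hdir : DirectedOn Le S) (hf : ∀ f ∈ S, IsCont f) (hg : IsCont g)
    (h : IsSup S g) : ∀ n, IsSup ((fun f => fixMap F f n) '' S) (fixMap F g n)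
  | 0 => isSup_const (hS.image _) (by rintro _ ⟨f, -, rfl⟩; rfl)
  | n + 1 => by
    have := hF.sup (X := (c, fixObj F c n)) (Y := (d, fixObj F d n))
      (S := (fun f => Prod.mkHom f (fixMap F f n)) '' S) (g := Prod.mkHom g (fixMap F g n))
      ⟨hc, isDom_fixObj hF hc n⟩ ⟨hd, isDom_fixObj hF hd n⟩ (hS.image _)
      (by
        rintro _ ⟨f, hf', rfl⟩ _ ⟨g, hg', rfl⟩
        obtain ⟨k, hk, hfk, hgk⟩ := hdir f hf' g hg'
        exact ⟨_, ⟨k, hk, rfl⟩, ⟨hfk, fixMap_le hF hc hd (hf f hf') (hf k hk) hfk n⟩,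
          ⟨hgk, fixMap_le hF hc hd (hf g hg') (hf k hk) hgk n⟩⟩)
      (by rintro _ ⟨f, hf', rfl⟩; exact ⟨hf f hf', isCont_fixMap hF hc hd (hf f hf') n⟩)
      ⟨hg, isCont_fixMap hF hc hd hg n⟩
      ⟨by rw [Set.image_image]; exact (Set.image_id' S).symm ▸ h, by
        rw [Set.image_image]; exact isSup_fixMap hc hd hS hdir hf hg h n⟩
    rw [Set.image_image] at this
    exact this

/-- The order on threads and the suprema used here are componentwise, so each clause reduces to its
counterpart for `fixMap`. -/
theorem isDomFunctor_dagger : IsDomFunctor (dagger F) where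
  obj h := isDom_dagger hF h
  map {c d} hc hd f hf := isCont_of_comp_daggerProj fun n =>
    (isCont_daggerProj hF hc n).comp (isCont_fixMap hF hc hd hf n)
  le hc hd _ _ hf hg h x n := fixMap_le hF hc hd hf hg h n (x.1 n)
  sup hc hd S g hS hdir hf hg h x := by
    refine dagger_isLUB fun n => ?_
    have := isSup_fixMap hF hc hd hS hdir hf hg h n (x.1 n)
    rw [Set.image_image] at this ⊢
    rw [Set.image_image]
    exact this

end Domains

end PPos

-- Simultaneous induction over session types and functional types

mutual

theorem SType.isDomFunctor_interp {Label : Type} : {n : ℕ} → {Ξ : Fin n → Polarity} →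
    {p : Polarity} → (A : SType Label Ξ p) → (q : Polarity) →
    IsDomFunctor (SType.interp.{u} A q)
  | _, _, _, .unit, q => by
    cases q <;> simp only [SType.interp]
    exacts [.const PPos.isDom_one, .const (PPos.isDom_one.lift)]
  | _, _, _, .var α _, q => by
    simp only [SType.interp]
    exact .eval α
  | n, _, _, .recur A, q => by
    simp only [SType.interp]
    exact PPos.isDomFunctor_dagger ((IsDomFunctor.extend n).comp (A.isDomFunctor_interp q))
  | _, _, _, .down A, q => by
    cases q <;> simp only [SType.interp]
    exacts [A.isDomFunctor_interp _, (A.isDomFunctor_interp _).comp .lift]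
  | _, _, _, .up A, q => by
    cases q <;> simp only [SType.interp]
    exacts [(A.isDomFunctor_interp _).comp .lift, A.isDomFunctor_interp _]
  | _, _, _, .plus L A, q => by
    cases q <;> simp only [SType.interp]
    exacts [.comp (.pi' fun l => (A l).isDomFunctor_interp _) (.pi _),
      .comp (.pi' fun l => ((A l).isDomFunctor_interp _).comp .lift) (.sum _)]
  | _, _, _, .amp L A, q => by
    cases q <;> simp only [SType.interp]
    exacts [.comp (.pi' fun l => ((A l).isDomFunctor_interp _).comp .lift) (.sum _),
      .comp (.pi' fun l => (A l).isDomFunctor_interp _) (.pi _)]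
  | _, _, _, .tensor A B, q => by
    have h := fun r s => ((A.isDomFunctor_interp r).prod' (B.isDomFunctor_interp s)).comp
      IsDomFunctor.prod
    cases q <;> simp only [SType.interp]
    exacts [h _ _, (h _ _).comp .lift]
  | _, _, _, .lolly A B, q => by
    have h := fun r s => ((A.isDomFunctor_interp r).prod' (B.isDomFunctor_interp s)).comp
      IsDomFunctor.prod
    cases q <;> simp only [SType.interp]
    exacts [(h _ _).comp .lift, h _ _]
  | _, _, _, .and τ A, q => by
    cases q <;> simp only [SType.interp]
    exacts [A.isDomFunctor_interp _, (((IsDomFunctor.const τ.isScottDomain_interp).prod'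
      (A.isDomFunctor_interp _)).comp IsDomFunctor.prod).comp .lift]
  | _, _, _, .imp τ A, q => by
    cases q <;> simp only [SType.interp]
    exacts [(((IsDomFunctor.const τ.isScottDomain_interp).prod'
      (A.isDomFunctor_interp _)).comp IsDomFunctor.prod).comp .lift, A.isDomFunctor_interp _]

theorem FType.isScottDomain_interp {Label : Type} :
    (τ : FType Label) → IsScottDomain (FType.interp.{u} τ)
  | .quoted A₀ k _ A => by
    simp only [FType.interp]
    exact (IsScottDomain.cfun
      ((IsScottDomain.pi fun i => ((A i).isDomFunctor_interp _).obj fun j => j.elim0).prod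
        ((A₀.isDomFunctor_interp _).obj fun j => j.elim0))
      ((IsScottDomain.pi fun i => ((A i).isDomFunctor_interp _).obj fun j => j.elim0).prod
        ((A₀.isDomFunctor_interp _).obj fun j => j.elim0))).lift
  | .arrow τ σ => by
    simp only [FType.interp]
    exact τ.isScottDomain_interp.sfun σ.isScottDomain_interp

end

/-! ### Functors on Scott domains -/

section Functors

variable {n : ℕ} {P : (Fin n → PPos.{u}) ⥤ PPos.{u}}

theorem IsDomFunctor.preservesScott (hP : IsDomFunctor P) : PreservesScott P where
  obj D := hP.obj fun i => (D i).isScott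
  map D E f := hP.map (fun i => (D i).isScott) (fun i => (E i).isScott) fun i => (f i).cont

/-- The underlying family of strict monotone maps. -/
abbrev toPPosHom {D E : Fin n → SDom.{u}} (f : D ⟶ E) :
    (fun i => (D i).toPPos : Fin n → PPos.{u}) ⟶ (fun i => (E i).toPPos) :=
  fun i => (f i).toHom

/-- Least upper bounds of directed sets of strict continuous maps are pointwise. -/
theorem isSup_of_isLUB {D E : Fin n → SDom.{u}} {S : Set (D ⟶ E)} {g : D ⟶ E} (hS : S.Nonempty)
    (hd : DirectedOn (· ≤ ·) S) (hg : IsLUB S g) : IsSup (toPPosHom '' S) (toPPosHom g) := by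
  have key : ∀ i, ∃ k : (D i).toPPos ⟶ (E i).toPPos,
      IsCont k ∧ IsSup ((fun f => (f i).toHom) '' S) k := by
    refine fun i => exists_isSup (E i).isScott (hS.image _) ?_ ?_
    · rintro _ ⟨f, hf, rfl⟩ _ ⟨g, hg, rfl⟩
      obtain ⟨k, hk, hfk, hgk⟩ := hd f hf g hg
      exact ⟨_, ⟨k, hk, rfl⟩, hfk i, hgk i⟩
    · rintro _ ⟨f, -, rfl⟩
      exact (f i).cont
  choose k hkc hk using key
  -- The pointwise supremum is continuous, so it is a least upper bound in the hom-set; by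
  -- uniqueness every least upper bound is pointwise.
  have hlub : IsLUB S (fun i => ⟨k i, hkc i⟩ : D ⟶ E) := by
    refine ⟨fun f hf i x => (hk i x).1 ⟨_, ⟨f, hf, rfl⟩, rfl⟩, fun f hf i x => (hk i x).2 ?_⟩
    rintro _ ⟨_, ⟨f', hf', rfl⟩, rfl⟩
    exact hf hf' i x
  rw [hg.unique hlub]
  intro i
  rw [Set.image_image]
  exact hk i

theorem IsDomFunctor.isLocallyContinuous (hP : IsDomFunctor P) (h : PreservesScott P) :
    IsLocallyContinuous h.functor := by
  intro D E S hS hd g hg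
  have hsup := hP.sup (fun i => (D i).isScott) (fun i => (E i).isScott) (hS.image toPPosHom)
    (by
      rintro _ ⟨f, hf, rfl⟩ _ ⟨g, hg, rfl⟩
      obtain ⟨k, hk, hfk, hgk⟩ := hd f hf g hg
      exact ⟨_, ⟨k, hk, rfl⟩, hfk, hgk⟩)
    (by rintro _ ⟨f, -, rfl⟩ i; exact (f i).cont) (fun i => (g i).cont)
    (isSup_of_isLUB hS hd hg)
  refine ⟨?_, fun f hf x => (hsup x).2 ?_⟩
  · rintro _ ⟨f, hf, rfl⟩ x
    exact (hsup x).1 ⟨_, ⟨_, ⟨f, hf, rfl⟩, rfl⟩, rfl⟩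
  · rintro _ ⟨_, ⟨_, ⟨f', hf', rfl⟩, rfl⟩, rfl⟩
    exact hf ⟨f', hf', rfl⟩ x

end Functors

/-! ### Canonical fixed points -/

namespace SDom

/-- An order isomorphism is lower adjoint to its inverse. -/
theorem isCont_of_iso {X Y : PPos.{u}} (e : X ≅ Y) : IsCont e.hom := by
  have hl : ∀ x, e.inv.toFun (e.hom.toFun x) = x := fun x =>
    congrArg (fun k => k.toFun x) e.hom_inv_id
  have hr : ∀ y, e.hom.toFun (e.inv.toFun y) = y := fun y =>
    congrArg (fun k => k.toFun y) e.inv_hom_id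
  refine GaloisConnection.scottContinuous (r := e.inv.toFun) fun x y => ⟨fun h => ?_, fun h => ?_⟩
  · exact (hl x).symm.le.trans (e.inv.mono h)
  · exact (e.hom.mono h).trans (hr y).le

/-- Isomorphisms of pointed posets between Scott domains are isomorphisms of Scott domains. -/
def isoOfPPos {X Y : SDom.{u}} (e : X.toPPos ≅ Y.toPPos) : X ≅ Y where
  hom := ⟨e.hom, isCont_of_iso e⟩
  inv := ⟨e.inv, isCont_of_iso e.symm⟩
  hom_inv_id := SDom.hom_ext e.hom_inv_id
  inv_hom_id := SDom.hom_ext e.inv_hom_id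

-- A criterion for a fixed point to be canonical

section CanonicalFixedPoint

variable {H : SDom.{u} ⥤ SDom.{u}} {X : SDom.{u}} (fold : H.obj X ≅ X)

/-- The embeddings of the iterates into a fixed point. -/
def fixedEmb : ∀ n, iter H n ⟶ X
  | 0 => botHom _ _
  | n + 1 => H.map (fixedEmb n) ≫ fold.hom

/-- The projections of a fixed point onto the iterates. -/
def fixedProj : ∀ n, X ⟶ iter H n
  | 0 => botHom _ _
  | n + 1 => fold.inv ≫ H.map (fixedProj n)

theorem one_hom_ext {Y : SDom.{u}} {f g : one ⟶ Y} : f = g :=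
  SDom.hom_ext PPos.one_hom_ext

theorem iterEmb_fixedEmb : ∀ n, iterEmb H n ≫ fixedEmb fold (n + 1) = fixedEmb fold n
  | 0 => one_hom_ext
  | n + 1 => by
    change H.map (iterEmb H n) ≫ H.map (fixedEmb fold (n + 1)) ≫ fold.hom = _
    rw [← Category.assoc, ← H.map_comp, iterEmb_fixedEmb n]
    rfl

theorem fixedProj_iterProj : ∀ n, fixedProj fold (n + 1) ≫ iterProj H n = fixedProj fold n
  | 0 => rfl
  | n + 1 => by
    change (fold.inv ≫ H.map (fixedProj fold (n + 1))) ≫ H.map (iterProj H n) = _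
    rw [Category.assoc, ← H.map_comp, fixedProj_iterProj n]
    rfl

theorem fixedEmb_fixedProj : ∀ n, fixedEmb fold n ≫ fixedProj fold n = 𝟙 (iter H n)
  | 0 => rfl
  | n + 1 => by
    change (H.map (fixedEmb fold n) ≫ fold.hom) ≫ fold.inv ≫ H.map (fixedProj fold n) = _
    rw [Category.assoc, fold.hom_inv_id_assoc, ← H.map_comp, fixedEmb_fixedProj n]
    exact H.map_id _

/-- The idempotents of a fixed point. -/
def fixedIdem (n : ℕ) : X ⟶ X := fixedProj fold n ≫ fixedEmb fold n

theorem fixedIdem_succ (n : ℕ) :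
    fixedIdem fold (n + 1) = fold.inv ≫ H.map (fixedIdem fold n) ≫ fold.hom := by
  change (fold.inv ≫ H.map (fixedProj fold n)) ≫ H.map (fixedEmb fold n) ≫ fold.hom = _
  rw [fixedIdem, H.map_comp, Category.assoc, Category.assoc]

theorem fixedIdem_le_succ (hH : ∀ f g : X ⟶ X, f ≤ g → H.map f ≤ H.map g) :
    ∀ n, fixedIdem fold n ≤ fixedIdem fold (n + 1)
  | 0 => fun _ => bot_le
  | n + 1 => by
    rw [fixedIdem_succ, fixedIdem_succ fold (n + 1)]
    exact fun x => fold.hom.toHom.mono (hH _ _ (fixedIdem_le_succ hH n) _)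

/-- The recursions for the embeddings and projections build in compatibility with `fold`, so the
supremum of the idempotents is the only property left to supply. -/
theorem isCanonicalFixedPoint_of_isLUB (h : IsLUB (Set.range (fixedIdem fold)) (𝟙 X)) :
    IsCanonicalFixedPoint H X fold := by
  refine ⟨fixedEmb fold, fixedProj fold, iterEmb_fixedEmb fold, fixedProj_iterProj fold,
    fixedEmb_fixedProj fold, h, fun _ => rfl, fun n => ?_⟩
  exact fold.hom_inv_id_assoc _

end CanonicalFixedPoint

-- The parametrized fixed point over Scott domains

section Param

variable {n : ℕ} {P : (Fin n.succ → PPos.{u}) ⥤ PPos.{u}}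

/-- The comparison between extending an environment of Scott domains and extending its underlying
environment of pointed posets. -/
def extendIso (D : Fin n → SDom.{u}) (X : SDom.{u}) :
    (fun i => ((extend SDom.{u} n).obj (D, X) i).toPPos : Fin (n + 1) → PPos.{u}) ≅
      (extend PPos.{u} n).obj (fun i => (D i).toPPos, X.toPPos) where
  hom i := Fin.cases (motive := fun i => ((extend SDom.{u} n).obj (D, X) i).toPPos ⟶
    (extend PPos.{u} n).obj (fun i => (D i).toPPos, X.toPPos) i) (𝟙 _) (fun _ => 𝟙 _) i
  inv i := Fin.cases (motive := fun i => (extend PPos.{u} n).obj (fun i => (D i).toPPos, X.toPPos) i ⟶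
    ((extend SDom.{u} n).obj (D, X) i).toPPos) (𝟙 _) (fun _ => 𝟙 _) i
  hom_inv_id := funext (Fin.cases rfl fun _ => rfl)
  inv_hom_id := funext (Fin.cases rfl fun _ => rfl)

theorem extendIso_naturality {D E : Fin n → SDom.{u}} {X Y : SDom.{u}} (f : D ⟶ E) (g : X ⟶ Y) :
    toPPosHom ((extend SDom.{u} n).map (Prod.mkHom f g)) ≫ (extendIso E Y).hom =
      (extendIso D X).hom ≫ (extend PPos.{u} n).map (Prod.mkHom (toPPosHom f) g.toHom) :=
  funext (Fin.cases rfl fun _ => rfl)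

theorem map_extendIso_naturality {D E : Fin n → SDom.{u}} {X Y : SDom.{u}} (f : D ⟶ E)
    (g : X ⟶ Y) :
    P.map (toPPosHom ((extend SDom.{u} n).map (Prod.mkHom f g))) ≫ P.map (extendIso E Y).hom =
      P.map (extendIso D X).hom ≫
        (extend PPos.{u} n ⋙ P).map (Prod.mkHom (toPPosHom f) g.toHom) :=
  (P.map_comp _ _).symm.trans ((congrArg P.map (extendIso_naturality f g)).trans (P.map_comp _ _))

/-- `Fold` is the structure map of the poset bilimit, transported along `extendIso`, and its
naturality is `PPos.fold_naturality`. Canonicity comes from the criterion on idempotents. -/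
theorem isParamFixedPoint_dagger (hP : IsDomFunctor P) (h : PreservesScott P)
    (hd : PreservesScott (PPos.dagger (extend PPos.{u} n ⋙ P))) :
    IsParamFixedPoint (extend SDom.{u} n ⋙ h.functor) hd.functor := by
  have hF : IsDomFunctor (extend PPos.{u} n ⋙ P) := (IsDomFunctor.extend n).comp hP
  have hD : ∀ D : Fin n → SDom.{u}, IsDom (fun i => (D i).toPPos : Fin n → PPos.{u}) :=
    fun D i => (D i).isScott
  let Fold : (𝟭 (Fin n → SDom.{u})).prod' hd.functor ⋙ extend SDom.{u} n ⋙ h.functor ≅ hd.functor :=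
    NatIso.ofComponents
      -- Extending an environment and passing to underlying posets commute only index by index,
      -- whence the comparison before folding.
      (fun D => isoOfPPos (P.mapIso (extendIso D (hd.functor.obj D)) ≪≫ PPos.foldIso hF (hD D)))
      (fun {D E} f => by
        refine SDom.hom_ext (PPos.hom_ext fun y => ?_)
        have h1 := congrArg (fun k => k.toFun y)
          (map_extendIso_naturality (P := P) f (hd.functor.map f))
        have h2 := congrArg (fun k => k.toFun ((P.map (extendIso D (hd.functor.obj D)).hom).toFun y))
          (PPos.fold_naturality (extend PPos.{u} n ⋙ P) (toPPosHom f))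
        exact (congrArg (PPos.fold (extend PPos.{u} n ⋙ P) fun i => (E i).toPPos).toFun h1).trans
          h2)
  refine ⟨Fold, fun D => isCanonicalFixedPoint_of_isLUB _ ?_⟩
  set X : SDom.{u} := hd.functor.obj D
  let D' : Fin n → PPos.{u} := fun i => (D i).toPPos
  set α : (Prod.sectR D SDom.{u} ⋙ extend SDom.{u} n ⋙ h.functor).obj X ≅ X := Fold.app D
  let π := fun m => PPos.daggerProj (extend PPos.{u} n ⋙ P) D' m
  have hmono : ∀ f g : X ⟶ X, f ≤ g →
      (Prod.sectR D SDom.{u} ⋙ extend SDom.{u} n ⋙ h.functor).map f ≤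
        (Prod.sectR D SDom.{u} ⋙ extend SDom.{u} n ⋙ h.functor).map g := by
    intro f g hfg
    refine hP.le (fun i => ((extend SDom.{u} n).obj (D, X) i).isScott)
      (fun i => ((extend SDom.{u} n).obj (D, X) i).isScott)
      (f := toPPosHom ((extend SDom.{u} n).map (Prod.mkHom (𝟙 D) f)))
      (g := toPPosHom ((extend SDom.{u} n).map (Prod.mkHom (𝟙 D) g)))
      (fun i => ((extend SDom.{u} n).map (Prod.mkHom (𝟙 D) f) i).cont)
      (fun i => ((extend SDom.{u} n).map (Prod.mkHom (𝟙 D) g) i).cont) ?_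
    exact Fin.cases hfg fun i => le_refl _
  -- Up to the comparison, folding and then projecting to component `m + 1` is the functor applied
  -- to `π m`. The induction hypothesis passes under the functor, and cancelling `α` against its
  -- inverse gives the next case.
  have hproj : ∀ m, (fixedIdem α m).toHom ≫ π m = π m := by
    intro m
    induction m with
    | zero => rfl
    | succ m ih =>
      rw [fixedIdem_succ]
      have h1 : α.hom.toHom ≫ π (m + 1) = P.map (extendIso D X).hom ≫
          (extend PPos.{u} n ⋙ P).map (Prod.mkHom (𝟙 D') (π m)) := rfl
      have h2 : ((Prod.sectR D SDom.{u} ⋙ extend SDom.{u} n ⋙ h.functor).map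
          (fixedIdem α m)).toHom ≫ α.hom.toHom ≫ π (m + 1) = α.hom.toHom ≫ π (m + 1) := by
        rw [h1]
        refine ((Category.assoc _ _ _).symm.trans (congrArg (· ≫ _)
          (map_extendIso_naturality (P := P) (𝟙 D) (fixedIdem α m)))).trans ?_
        refine (Category.assoc _ _ _).trans (congrArg (P.map (extendIso D X).hom ≫ ·) ?_)
        refine ((extend PPos.{u} n ⋙ P).map_comp _ _).symm.trans
          (congrArg (extend PPos.{u} n ⋙ P).map ?_)
        exact Prod.ext rfl ih
      refine PPos.hom_ext fun x => ?_
      have h3 : α.hom.toHom.toFun (α.inv.toHom.toFun x) = x :=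
        congrArg (fun k => k.toHom.toFun x) α.inv_hom_id
      exact (congrArg (fun k => k.toFun (α.inv.toHom.toFun x)) h2).trans
        (congrArg (π (m + 1)).toFun h3)
  have hlub : ∀ x, IsLUB (Set.range fun m => (fixedIdem α m).toHom.toFun x) x := fun x =>
    PPos.isLUB_of_comp_daggerProj (g := fun m => (fixedIdem α m).toHom) x
      (monotone_nat_of_le_succ fun m => fixedIdem_le_succ α hmono m x) hproj
  refine ⟨?_, fun f hf x => (hlub x).2 ?_⟩
  · rintro _ ⟨m, rfl⟩ x
    exact (hlub x).1 ⟨m, rfl⟩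
  · rintro _ ⟨m, rfl⟩
    exact hf ⟨m, rfl⟩ x

end Param

end SDom

end SessionTypes

-- The main theorem

open SessionTypes in
/-- The aspects of every open session type are locally continuous functors from `⟦Ξ⟧` to Scott
domains with strict continuous maps, and recursive types denote parametrized canonical fixed
points of locally continuous functors. -/
theorem mainTheorem1 (Label : Type) :
    (∀ {n : ℕ} {Ξ : Fin n → Polarity} {p : Polarity} (A : SType Label Ξ p) (q : Polarity),
      ∃ h : PreservesScott.{u} (A.interp q), IsLocallyContinuous h.functor) ∧
    (∀ {n : ℕ} {Ξ : Fin n → Polarity} {p : Polarity}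
      (A : SType Label (Fin.cons p Ξ : Fin (n + 1) → Polarity) p) (q : Polarity)
      (hA : PreservesScott.{u} (A.interp q)) (hR : PreservesScott.{u} (A.recur.interp q)),
      SDom.IsParamFixedPoint (extend SDom.{u} n ⋙ hA.functor) hR.functor) := by
  refine ⟨fun A q => ⟨(A.isDomFunctor_interp q).preservesScott,
    (A.isDomFunctor_interp q).isLocallyContinuous _⟩, fun A q hA hR => ?_⟩
  -- Reverting `hR` lets the unfolding to `dagger` act on its type as well as on the goal.
  revert hR
  rw [SType.interp]
  exact fun hR => SDom.isParamFixedPoint_dagger (A.isDomFunctor_interp q) hA hR
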